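/- Let $\theta_0,\sigma_0^2\in(0,\infty)$ and let $Z=\{Z(s)\}_{s\in[0,1]}$ be a zero-mean Gaussian process with $\mathrm{cov}(Z(s),Z(t))=\sigma_0^2e^{-\theta_0|s-t|}$. For every $n$ let $s_1^{(n)}<\dots<s_n^{(n)}$ be points of $[0,1]$ (written $s_1<\dots<s_n$). Let $(w_k)_{k\ge1}$ be a fixed sequence of non-negative numbers, not all zero, and let $K=\sup\{k\ge 1: w_k\neq0\}$. For $\psi=(\theta,\sigma^2)\in(0,\infty)^2$ and distinct $s,t\in[0,1]$ put \[ \ell_{t|s}(\psi)=\ln(\sigma^2)+\ln\bigl(1-e^{-2\theta|s-t|}\bigr)+\frac{\{Z(t)-e^{-\theta|s-t|}Z(s)\}^2}{\sigma^2(1-e^{-2\theta|s-t|})}, \qquad pc\ell_n(\psi)=\sum_{i=1}^n\sum_{\substack{j=1\\ j\ne i}}^n w_{|i-j|}\,\ell_{s_j|s_i}(\psi), \] and, for $J\subset(0,\infty)^2$, call any minimizer $\hat\psi_n=(\hat\theta_n,\hat\sigma_n^2)\in\mathrm{argmin}_{\psi\in J}\,pc\ell_n(\psi)$ a weighted pairwise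 conditional maximum likelihood estimator (WPCMLE). Assume that $K<\infty$. Let $0<a\le b<\infty$ and $0<c\le d<\infty$ be fixed, let $J=[a,b]\times[c,d]$, $J=[a,b]\times(0,\infty)$ or $J=(0,\infty)\times[c,d]$, and assume that there is $(\tilde\theta,\tilde\sigma^2)\in J$ with $\tilde\theta\tilde\sigma^2=\theta_0\sigma_0^2$. Then, almost surely, a WPCMLE exists for all sufficiently large $n$, and for every choice of WPCMLEs $\hat\psi_n$ for all large $n$, $\hat\theta_n\hat\sigma_n^2\to\theta_0\sigma_0^2$ as $n\to\infty$. -/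

import Mathlib

open MeasureTheory ProbabilityTheory Filter Topology Set

/-- `Z`, indexed by `[0,1]`, is a zero-mean Gaussian process under `P` with covariance function
`cov (Z s, Z t) = v₀ * exp (-θ₀ * |s - t|)` (the stationary Ornstein-Uhlenbeck process with scale
parameter `θ₀` and variance parameter `v₀`). -/
structure IsStationaryOU {Ω : Type*} [MeasurableSpace Ω] (P : Measure Ω)
    (Z : unitInterval → Ω → ℝ) (θ₀ v₀ : ℝ) : Prop where
  gaussian : IsGaussianProcess Z P
  mean_zero : ∀ t, ∫ ω, Z t ω ∂P = 0
  cov_eq : ∀ s t : unitInterval,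
    covariance (Z s) (Z t) P = v₀ * Real.exp (-θ₀ * |(s : ℝ) - (t : ℝ)|)

/-- The conditional log-likelihood criterion `ℓ_{t|s}(ψ)` at `ψ = (θ, σ²)`, for a realization
`z : [0,1] → ℝ` of the process: `-2` times the logarithm of the conditional density of `z t` given
`z s`, up to an additive constant. -/
noncomputable def condLogLik (z : unitInterval → ℝ) (t s : unitInterval) (ψ : ℝ × ℝ) : ℝ :=
  Real.log ψ.2 + Real.log (1 - Real.exp (-2 * ψ.1 * |(s : ℝ) - (t : ℝ)|))
    + (z t - Real.exp (-ψ.1 * |(s : ℝ) - (t : ℝ)|) * z s) ^ 2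
      / (ψ.2 * (1 - Real.exp (-2 * ψ.1 * |(s : ℝ) - (t : ℝ)|)))

/-- The weighted pairwise conditional log-likelihood
`∑_i ∑_{j ≠ i} w_{i,j} ℓ_{s_j | s_i}(ψ)` with stationary weights `w_{i,j} = w_{|i - j|}`, for `n`
observation points `s`. The value `w 0` is never used. -/
noncomputable def pairCondLogLik (w : ℕ → ℝ) {n : ℕ} (s : Fin n → unitInterval)
    (z : unitInterval → ℝ) (ψ : ℝ × ℝ) : ℝ :=
  ∑ i : Fin n, ∑ j ∈ Finset.univ.filter (fun j : Fin n => j ≠ i),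
    w (Nat.dist (i : ℕ) (j : ℕ)) * condLogLik z (s j) (s i) ψ

/-- `ψ` is a weighted pairwise conditional maximum likelihood estimate over the parameter set `J`:
a global minimizer over `J` of the weighted pairwise conditional log-likelihood criterion. -/
def IsWPCMLE (J : Set (ℝ × ℝ)) (w : ℕ → ℝ) {n : ℕ} (s : Fin n → unitInterval)
    (z : unitInterval → ℝ) (ψ : ℝ × ℝ) : Prop :=
  ψ ∈ J ∧ ∀ φ ∈ J, pairCondLogLik w s z ψ ≤ pairCondLogLik w s z φ

/-!
Only the product of scale and variance is visible in high-frequency data. For a pair of sites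
`s < t`, the mean of the two conditional criteria at `ψ`, minus its value at a reference parameter
`ψ₀` with `ψ₀.1 * ψ₀.2 = G := θ₀ * v₀`, is `log x + Y / x - Y` up to small errors, where
`x = ψ.1 * ψ.2 / G` and `Y = (Z t - Z s) ^ 2 / (2 * G * (t - s))`. So once the weighted mean of
the `Y` tends to `1`, a minimizer must have `log x + 1 / x` close to `1`, hence `x` close to `1`.

The mean of the `Y` converges since `Y` is close to the square of the normalized innovation
`Z t - exp (-θ₀ (t - s)) * Z s`. By the Markov property, the innovations over the pairs of a fixed
lag `k` in a fixed residue class mod `k` are independent, and their squares obey a strong law with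
exponential tails. All errors are of the order of the gap `t - s` times the square of the path or of
an innovation; the gaps at lag `k` add up to at most `k`, while these squares are almost surely
`o(n)` uniformly over the sites, so the errors vanish in the mean.
-/

section SubexponentialMGF

variable {Ω : Type*} [MeasurableSpace Ω] {P : Measure Ω}

/-- Bernstein's condition: near the origin, the moment generating function of `Y` is dominated by
the Gaussian one `t ↦ exp (C * t ^ 2)`. It gives exponential tails to sums of independent
variables, hence almost sure limits along triangular arrays. -/
structure HasSubexponentialMGF (Y : Ω → ℝ) (C τ : ℝ) (P : Measure Ω) : Prop where
  integrable_exp_mul : ∀ t, |t| ≤ τ → Integrable (fun ω => Real.exp (t * Y ω)) P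
  mgf_le : ∀ t, |t| ≤ τ → mgf Y P t ≤ Real.exp (C * t ^ 2)

namespace HasSubexponentialMGF

variable {Y : Ω → ℝ} {C C' τ t r : ℝ}

lemma mono (hY : HasSubexponentialMGF Y C τ P) (hC : C ≤ C') :
    HasSubexponentialMGF Y C' τ P where
  integrable_exp_mul := hY.integrable_exp_mul
  mgf_le t ht := (hY.mgf_le t ht).trans (by gcongr)

lemma aemeasurable (hY : HasSubexponentialMGF Y C τ P) (hτ : 0 < τ) : AEMeasurable Y P :=
  aemeasurable_of_integrable_exp_mul hτ.ne (hY.integrable_exp_mul 0 (by simpa using hτ.le))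
    (hY.integrable_exp_mul τ (abs_of_pos hτ).le)

lemma measureReal_ge_le [IsFiniteMeasure P] (hY : HasSubexponentialMGF Y C τ P) (ht : 0 ≤ t)
    (htτ : t ≤ τ) : P.real {ω | r ≤ Y ω} ≤ Real.exp (C * t ^ 2 - t * r) := by
  have ht' : |t| ≤ τ := by rwa [abs_of_nonneg ht]
  calc P.real {ω | r ≤ Y ω} ≤ Real.exp (-t * r) * mgf Y P t :=
        measure_ge_le_exp_mul_mgf r ht (hY.integrable_exp_mul t ht')
    _ ≤ Real.exp (-t * r) * Real.exp (C * t ^ 2) := by gcongr; exact hY.mgf_le t ht'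
    _ = Real.exp (C * t ^ 2 - t * r) := by rw [← Real.exp_add]; ring_nf

protected lemma neg (hY : HasSubexponentialMGF Y C τ P) :
    HasSubexponentialMGF (-Y) C τ P where
  integrable_exp_mul t ht := by
    simpa only [Pi.neg_apply, mul_neg, neg_mul] using hY.integrable_exp_mul (-t) (by rwa [abs_neg])
  mgf_le t ht := by
    simpa only [mgf_neg, neg_sq] using hY.mgf_le (-t) (by rwa [abs_neg])

lemma measureReal_abs_ge_le [IsFiniteMeasure P] (hY : HasSubexponentialMGF Y C τ P)
    (ht : 0 ≤ t) (htτ : t ≤ τ) :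
    P.real {ω | r ≤ |Y ω|} ≤ 2 * Real.exp (C * t ^ 2 - t * r) :=
  calc P.real {ω | r ≤ |Y ω|} = P.real ({ω | r ≤ Y ω} ∪ {ω | r ≤ -Y ω}) := by
        simp only [le_abs, ofPred_or]
    _ ≤ P.real {ω | r ≤ Y ω} + P.real {ω | r ≤ -Y ω} := measureReal_union_le _ _
    _ ≤ Real.exp (C * t ^ 2 - t * r) + Real.exp (C * t ^ 2 - t * r) :=
        add_le_add (hY.measureReal_ge_le ht htτ) (hY.neg.measureReal_ge_le ht htτ)
    _ = 2 * Real.exp (C * t ^ 2 - t * r) := (two_mul _).symm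

protected lemma sum [IsProbabilityMeasure P] {ι : Type*} [Fintype ι] {Y : ι → Ω → ℝ} (hτ : 0 < τ)
    (hind : iIndepFun Y P) (hY : ∀ i, HasSubexponentialMGF (Y i) C τ P) :
    HasSubexponentialMGF (∑ i, Y i) (Fintype.card ι * C) τ P := by
  have hmgf (t : ℝ) : mgf (∑ i, Y i) P t = ∏ i, mgf (Y i) P t :=
    hind.mgf_sum₀ (fun i => (hY i).aemeasurable hτ) _
  constructor
  · intro t ht
    have hpos : 0 < mgf (∑ i, Y i) P t :=
      hmgf t ▸ Finset.prod_pos fun i _ => mgf_pos ((hY i).integrable_exp_mul t ht)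
    exact not_imp_comm.1 integral_undef hpos.ne'
  · intro t ht
    calc mgf (∑ i, Y i) P t = ∏ i, mgf (Y i) P t := hmgf t
      _ ≤ ∏ _i : ι, Real.exp (C * t ^ 2) :=
          Finset.prod_le_prod (fun i _ => mgf_nonneg) fun i _ => (hY i).mgf_le t ht
      _ = Real.exp (Fintype.card ι * C * t ^ 2) := by
          rw [Finset.prod_const, Finset.card_univ, ← Real.exp_nat_mul, mul_assoc]

end HasSubexponentialMGF

lemma ae_eventually_forall_lt_of_summable [IsFiniteMeasure P] {ι : ℕ → Type*}
    [∀ n, Fintype (ι n)] {f : ∀ n, ι n → Ω → ℝ}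
    (hf : ∀ ε > 0, Summable fun n => ∑ i, P.real {ω | ε ≤ f n i ω}) :
    ∀ᵐ ω ∂P, ∀ ε > 0, ∀ᶠ n in atTop, ∀ i, f n i ω < ε := by
  have h_fixed (ε : ℝ) (hε : 0 < ε) : ∀ᵐ ω ∂P, ∀ᶠ n in atTop, ∀ i, f n i ω < ε := by
    have h_tsum : ∑' n, P (⋃ i, {ω | ε ≤ f n i ω}) ≠ ⊤ := by
      refine ne_top_of_le_ne_top (hf ε hε).tsum_ofReal_ne_top (ENNReal.tsum_le_tsum fun n => ?_)
      rw [← ofReal_measureReal]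
      exact ENNReal.ofReal_le_ofReal (measureReal_iUnion_fintype_le _)
    filter_upwards [ae_eventually_notMem h_tsum] with ω hω
    exact hω.mono fun n hn i => not_le.1 fun hi => hn (mem_iUnion.2 ⟨i, hi⟩)
  filter_upwards [ae_all_iff.2 fun m : ℕ => h_fixed _ (Nat.one_div_pos_of_nat (n := m))]
    with ω hω ε hε
  obtain ⟨m, hm⟩ := exists_nat_one_div_lt hε
  exact (hω m).mono fun n hn i => (hn i).trans hm

lemma ae_eventually_forall_abs_div_lt [IsFiniteMeasure P] {ι : ℕ → Type*} [∀ n, Fintype (ι n)]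
    {p : ℕ} (hι : ∀ n, Fintype.card (ι n) ≤ n ^ p) {Y : ∀ n, ι n → Ω → ℝ} {C τ : ℝ} (hτ : 0 < τ)
    (hY : ∀ n i, HasSubexponentialMGF (Y n i) (C * (n + 1)) τ P) :
    ∀ᵐ ω ∂P, ∀ ε > 0, ∀ᶠ n : ℕ in atTop, ∀ i, |Y n i ω / n| < ε := by
  refine ae_eventually_forall_lt_of_summable fun ε hε => ?_
  obtain ⟨t, htC, ht, htτ⟩ : ∃ t, C * t ≤ ε / 2 ∧ t ∈ Ioc 0 τ := by
    have h_lim : Tendsto (fun t => C * t) (𝓝[>] 0) (𝓝 0) := by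
      simpa using (tendsto_id.const_mul C).mono_left (nhdsWithin_le_nhds (a := (0 : ℝ)))
    exact ((h_lim.eventually_le_const (half_pos hε)).and (Ioc_mem_nhdsGT hτ)).exists
  have h_tail (n : ℕ) (i : ι n) : P.real {ω | ε ≤ |Y n i ω / n|} ≤
      2 * Real.exp (C * t ^ 2) * Real.exp (-(ε * t / 2) * n) := by
    calc P.real {ω | ε ≤ |Y n i ω / n|} ≤ P.real {ω | ε * n ≤ |Y n i ω|} := by
          refine measureReal_mono fun ω hω => ?_
          rw [mem_ofPred_eq, abs_div, Nat.abs_cast] at hω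
          exact mul_le_of_le_div₀ (abs_nonneg _) n.cast_nonneg hω
      _ ≤ 2 * Real.exp (C * (n + 1) * t ^ 2 - t * (ε * n)) :=
          (hY n i).measureReal_abs_ge_le ht.le htτ
      _ ≤ 2 * Real.exp (C * t ^ 2) * Real.exp (-(ε * t / 2) * n) := by
          rw [mul_assoc 2, ← Real.exp_add]
          gcongr
          nlinarith [mul_le_mul_of_nonneg_right htC (by positivity : 0 ≤ n * t)]
  have h_summable : Summable fun n : ℕ => 2 * Real.exp (C * t ^ 2) *
      (n ^ p * Real.exp (-(ε * t / 2) * n)) :=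
    (Real.summable_pow_mul_exp_neg_nat_mul p (by positivity)).mul_left _
  refine h_summable.of_nonneg_of_le (fun n => Finset.sum_nonneg fun i _ => measureReal_nonneg)
    fun n => ?_
  calc ∑ i, P.real {ω | ε ≤ |Y n i ω / n|}
      ≤ Fintype.card (ι n) * (2 * Real.exp (C * t ^ 2) * Real.exp (-(ε * t / 2) * n)) := by
        simpa using Finset.sum_le_card_nsmul Finset.univ _ _ fun i _ => h_tail n i
    _ ≤ n ^ p * (2 * Real.exp (C * t ^ 2) * Real.exp (-(ε * t / 2) * n)) := by
        gcongr
        exact_mod_cast hι n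
    _ = _ := by ring

lemma ae_tendsto_sum_div_of_iIndepFun [IsProbabilityMeasure P] {ι : ℕ → Type*}
    [∀ n, Fintype (ι n)] (hι : ∀ n, Fintype.card (ι n) ≤ n) {Y : ∀ n, ι n → Ω → ℝ}
    (hind : ∀ n, iIndepFun (Y n) P) {C τ : ℝ} (hC : 0 ≤ C) (hτ : 0 < τ)
    (hY : ∀ n i, HasSubexponentialMGF (Y n i) C τ P) :
    ∀ᵐ ω ∂P, Tendsto (fun n => (∑ i, Y n i ω) / n) atTop (𝓝 0) := by
  have h_sum (n : ℕ) : HasSubexponentialMGF (∑ i, Y n i) (C * (n + 1)) τ P := by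
    refine (HasSubexponentialMGF.sum hτ (hind n) (hY n)).mono ?_
    have : (Fintype.card (ι n) : ℝ) ≤ n := by exact_mod_cast hι n
    nlinarith
  filter_upwards [ae_eventually_forall_abs_div_lt (ι := fun _ => Unit) (p := 0) (by simp) hτ
    fun n _ => h_sum n] with ω hω
  rw [Metric.tendsto_nhds]
  intro ε hε
  simpa only [Real.dist_eq, sub_zero, Finset.sum_apply, forall_const] using hω ε hε

end SubexponentialMGF

section StandardNormal

lemma integral_exp_mul_sq_sub_one_gaussianReal {t : ℝ} (ht : t < 1 / 2) :
    ∫ x, Real.exp (t * (x ^ 2 - 1)) ∂(gaussianReal 0 1) =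
      Real.exp (-t) * (√(1 - 2 * t))⁻¹ := by
  have h_density (x : ℝ) : gaussianPDFReal 0 1 x • Real.exp (t * (x ^ 2 - 1)) =
      (√(2 * Real.pi))⁻¹ * Real.exp (-t) * Real.exp (-(1 / 2 - t) * x ^ 2) := by
    simp only [gaussianPDFReal, NNReal.coe_one, mul_one, sub_zero, smul_eq_mul]
    rw [mul_assoc, mul_assoc, ← Real.exp_add, ← Real.exp_add]
    ring_nf
  have h_div : Real.pi / (1 / 2 - t) = 2 * Real.pi * (1 - 2 * t)⁻¹ := by
    have : 1 - 2 * t ≠ 0 := by linarith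
    have : 1 / 2 - t ≠ 0 := by linarith
    field_simp
  rw [integral_gaussianReal_eq_integral_smul one_ne_zero, integral_congr_ae (.of_forall h_density),
    integral_const_mul, integral_gaussian, h_div, Real.sqrt_mul (by positivity) (1 - 2 * t)⁻¹,
    Real.sqrt_inv]
  have : √(2 * Real.pi) ≠ 0 := by positivity
  field_simp

lemma exp_neg_mul_inv_sqrt_le {t : ℝ} (ht : |t| ≤ 1 / 4) :
    Real.exp (-t) * (√(1 - 2 * t))⁻¹ ≤ Real.exp (4 * t ^ 2) := by
  obtain ⟨_, ht'⟩ := abs_le.1 ht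
  have h_pos : 0 < 1 - 2 * t := by linarith
  have h_inv : (1 - 2 * t)⁻¹ ≤ 1 + 2 * t + 8 * t ^ 2 := by
    rw [inv_le_iff_one_le_mul₀ h_pos]
    nlinarith [sq_nonneg t, mul_nonneg (sq_nonneg t) (by linarith : 0 ≤ 1 / 4 - t)]
  have h_log : -2 * t - 8 * t ^ 2 ≤ Real.log (1 - 2 * t) := by
    linarith [Real.one_sub_inv_le_log_of_pos h_pos]
  have h_sqrt : √(1 - 2 * t) = Real.exp (Real.log (1 - 2 * t) / 2) := by
    rw [Real.exp_half, Real.exp_log h_pos]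
  rw [h_sqrt, ← Real.exp_neg, ← Real.exp_add]
  gcongr
  linarith

variable {Ω : Type*} [MeasurableSpace Ω] {P : Measure Ω} {X : Ω → ℝ}

lemma hasSubexponentialMGF_sq_sub_one (hX : HasLaw X (gaussianReal 0 1) P) :
    HasSubexponentialMGF (fun ω => X ω ^ 2 - 1) 4 (1 / 4) P := by
  have h_lt {t : ℝ} (ht : |t| ≤ 1 / 4) : t < 1 / 2 := by linarith [(abs_le.1 ht).2]
  have h_mgf {t : ℝ} (ht : |t| ≤ 1 / 4) :
      mgf (fun ω => X ω ^ 2 - 1) P t = Real.exp (-t) * (√(1 - 2 * t))⁻¹ :=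
    (hX.integral_comp (f := fun x => Real.exp (t * (x ^ 2 - 1))) (by fun_prop)).trans
      (integral_exp_mul_sq_sub_one_gaussianReal (h_lt ht))
  refine ⟨fun t ht => ?_, fun t ht => (h_mgf ht).trans_le (exp_neg_mul_inv_sqrt_le ht)⟩
  have h_pos : 0 < mgf (fun ω => X ω ^ 2 - 1) P t := by
    have : 0 < 1 - 2 * t := by linarith [h_lt ht]
    rw [h_mgf ht]
    positivity
  exact not_imp_comm.1 integral_undef h_pos.ne'

lemma ae_eventually_forall_sq_le [IsFiniteMeasure P] {ι : ℕ → Type*} [∀ n, Fintype (ι n)]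
    {p : ℕ} (hι : ∀ n, Fintype.card (ι n) ≤ n ^ p) {X : ∀ n, ι n → Ω → ℝ}
    (hX : ∀ n i, HasLaw (X n i) (gaussianReal 0 1) P) :
    ∀ᵐ ω ∂P, ∀ ε > 0, ∀ᶠ n : ℕ in atTop, ∀ i, X n i ω ^ 2 ≤ ε * n := by
  filter_upwards [ae_eventually_forall_abs_div_lt (C := 4) hι (by norm_num)
    fun n i => (hasSubexponentialMGF_sq_sub_one (hX n i)).mono
      (by linarith [n.cast_nonneg (α := ℝ)])] with ω hω ε hε
  filter_upwards [hω (ε / 2) (half_pos hε), eventually_gt_atTop 0,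
    tendsto_natCast_atTop_atTop.eventually_ge_atTop (2 / ε)] with n hn hn_pos hn_ge i
  have hn_pos' : (0 : ℝ) < n := by exact_mod_cast hn_pos
  have h_lt := (div_lt_iff₀ hn_pos').1 ((le_abs_self _).trans_lt (hn i))
  have h_one := (div_le_iff₀' hε).1 hn_ge
  linarith

end StandardNormal

/-- The standardized innovation between the times `s < t` of a path `z` of the
Ornstein–Uhlenbeck process: the residual of the regression of `z t` on `z s`, divided by its
standard deviation. -/
noncomputable def innovation (θ v : ℝ) (z : unitInterval → ℝ) (s t : unitInterval) : ℝ :=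
  (z t - Real.exp (-θ * ((t : ℝ) - s)) * z s) / √(v * (1 - Real.exp (-2 * θ * ((t : ℝ) - s))))

section OrnsteinUhlenbeck

variable {Ω : Type*} [MeasurableSpace Ω] {P : Measure Ω}

lemma hasLaw_gaussianReal_zero_one {X : Ω → ℝ} (hX : HasGaussianLaw X P)
    (h_mean : ∫ ω, X ω ∂P = 0) (h_cov : covariance X X P = 1) :
    HasLaw X (gaussianReal 0 1) P := by
  refine ⟨hX.aemeasurable, ?_⟩
  rw [hX.map_eq_gaussianReal, h_mean, ← covariance_self hX.aemeasurable, h_cov, Real.toNNReal_one]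

namespace IsStationaryOU

variable {Z : unitInterval → Ω → ℝ} {θ v : ℝ} {r s t : unitInterval}

lemma memLp_two (hZ : IsStationaryOU P Z θ v) (t : unitInterval) : MemLp (Z t) 2 P :=
  (hZ.gaussian.hasGaussianLaw_eval t).memLp_two

lemma covariance_of_le (hZ : IsStationaryOU P Z θ v) (hst : s ≤ t) :
    covariance (Z s) (Z t) P = v * Real.exp (-θ * ((t : ℝ) - s)) := by
  rw [hZ.cov_eq, abs_sub_comm, abs_of_nonneg (sub_nonneg.2 (Subtype.coe_le_coe.2 hst))]

lemma hasLaw_div_sqrt (hZ : IsStationaryOU P Z θ v) (hv : 0 < v) (t : unitInterval) :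
    HasLaw (fun ω => Z t ω / √v) (gaussianReal 0 1) P := by
  refine hasLaw_gaussianReal_zero_one ?_ ?_ ?_
  · simpa only [div_eq_inv_mul, smul_eq_mul] using
      (hZ.gaussian.hasGaussianLaw_eval t).fun_smul (√v)⁻¹
  · rw [integral_div, hZ.mean_zero, zero_div]
  · rw [covariance_fun_div_left, covariance_fun_div_right, div_div, Real.mul_self_sqrt hv.le,
      hZ.covariance_of_le le_rfl, sub_self, mul_zero, Real.exp_zero, mul_one, div_self hv.ne']

lemma isGaussianProcess_innovation (hZ : IsStationaryOU P Z θ v) :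
    IsGaussianProcess (fun (p : unitInterval × unitInterval) ω =>
      innovation θ v (Z · ω) p.1 p.2) P := by
  classical
  refine hZ.gaussian.of_isGaussianProcess fun p => ⟨{p.1, p.2}, ?_⟩
  let z₁ : (({p.1, p.2} : Finset unitInterval) → ℝ) →L[ℝ] ℝ :=
    ContinuousLinearMap.proj ⟨p.1, by simp⟩
  let z₂ : (({p.1, p.2} : Finset unitInterval) → ℝ) →L[ℝ] ℝ :=
    ContinuousLinearMap.proj ⟨p.2, by simp⟩
  refine ⟨(√(v * (1 - Real.exp (-2 * θ * ((p.2 : ℝ) - p.1)))))⁻¹ •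
    (z₂ - Real.exp (-θ * ((p.2 : ℝ) - p.1)) • z₁), fun ω => ?_⟩
  simp [z₁, z₂, innovation, div_eq_inv_mul]

lemma integral_innovation (hZ : IsStationaryOU P Z θ v) (s t : unitInterval) :
    ∫ ω, innovation θ v (Z · ω) s t ∂P = 0 := by
  have h_int (u : unitInterval) : Integrable (Z u) P :=
    (hZ.gaussian.hasGaussianLaw_eval u).integrable
  simp only [innovation]
  rw [integral_div, integral_sub (h_int _) ((h_int _).const_mul _), integral_const_mul,
    hZ.mean_zero, hZ.mean_zero, mul_zero, sub_zero, zero_div]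

lemma memLp_two_innovation (hZ : IsStationaryOU P Z θ v) (s t : unitInterval) :
    MemLp (fun ω => innovation θ v (Z · ω) s t) 2 P :=
  (hZ.isGaussianProcess_innovation.hasGaussianLaw_eval (s, t)).memLp_two

variable [IsFiniteMeasure P]

lemma covariance_innovation_right (hZ : IsStationaryOU P Z θ v) {X : Ω → ℝ} (hX : MemLp X 2 P)
    (s t : unitInterval) :
    covariance X (fun ω => innovation θ v (Z · ω) s t) P =
      (covariance X (Z t) P - Real.exp (-θ * ((t : ℝ) - s)) * covariance X (Z s) P)
        / √(v * (1 - Real.exp (-2 * θ * ((t : ℝ) - s)))) := by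
  simp only [innovation]
  rw [covariance_fun_div_right, covariance_fun_sub_right hX (hZ.memLp_two t)
    ((hZ.memLp_two s).const_mul _), covariance_const_mul_right]

lemma covariance_innovation_of_le (hZ : IsStationaryOU P Z θ v) (hrs : r ≤ s) (hst : s ≤ t) :
    covariance (Z r) (fun ω => innovation θ v (Z · ω) s t) P = 0 := by
  rw [hZ.covariance_innovation_right (hZ.memLp_two r), hZ.covariance_of_le (hrs.trans hst),
    hZ.covariance_of_le hrs, mul_left_comm, ← Real.exp_add]
  ring_nf

lemma covariance_innovation_innovation_of_le (hZ : IsStationaryOU P Z θ v) {s' t' : unitInterval}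
    (hst : s ≤ t) (hts' : t ≤ s') (hst' : s' ≤ t') :
    covariance (fun ω => innovation θ v (Z · ω) s t)
      (fun ω => innovation θ v (Z · ω) s' t') P = 0 := by
  rw [covariance_comm, hZ.covariance_innovation_right (hZ.memLp_two_innovation s' t'),
    covariance_comm, hZ.covariance_innovation_of_le hts' hst', covariance_comm,
    hZ.covariance_innovation_of_le (hst.trans hts') hst']
  simp only [mul_zero, sub_zero, zero_div]

lemma covariance_innovation_self (hZ : IsStationaryOU P Z θ v) (hθ : 0 < θ) (hv : 0 < v)
    (hst : s < t) :
    covariance (fun ω => innovation θ v (Z · ω) s t)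
      (fun ω => innovation θ v (Z · ω) s t) P = 1 := by
  have h_gap : 0 < (t : ℝ) - s := sub_pos.2 hst
  have h_pos : 0 < v * (1 - Real.exp (-2 * θ * ((t : ℝ) - s))) :=
    mul_pos hv (sub_pos.2 (Real.exp_lt_one_iff.2 (by nlinarith)))
  have h_sq : Real.exp (-2 * θ * ((t : ℝ) - s)) = Real.exp (-θ * ((t : ℝ) - s)) ^ 2 := by
    rw [← Real.exp_nat_mul]
    ring_nf
  have h_future : covariance (Z t) (fun ω => innovation θ v (Z · ω) s t) P =
      v * (1 - Real.exp (-2 * θ * ((t : ℝ) - s))) /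
        √(v * (1 - Real.exp (-2 * θ * ((t : ℝ) - s)))) := by
    rw [hZ.covariance_innovation_right (hZ.memLp_two t), hZ.covariance_of_le le_rfl,
      covariance_comm, hZ.covariance_of_le hst.le, h_sq, sub_self, mul_zero, Real.exp_zero]
    ring
  rw [hZ.covariance_innovation_right (hZ.memLp_two_innovation s t), covariance_comm, h_future,
    covariance_comm, hZ.covariance_innovation_of_le le_rfl hst.le, mul_zero, sub_zero, div_div,
    Real.mul_self_sqrt h_pos.le, div_self h_pos.ne']

lemma hasLaw_innovation (hZ : IsStationaryOU P Z θ v) (hθ : 0 < θ) (hv : 0 < v) (hst : s < t) :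
    HasLaw (fun ω => innovation θ v (Z · ω) s t) (gaussianReal 0 1) P :=
  hasLaw_gaussianReal_zero_one (hZ.isGaussianProcess_innovation.hasGaussianLaw_eval (s, t))
    (hZ.integral_innovation s t) (hZ.covariance_innovation_self hθ hv hst)

lemma iIndepFun_innovation (hZ : IsStationaryOU P Z θ v) {ι : Type*} [Finite ι]
    {a b : ι → unitInterval} (hab : ∀ i, a i ≤ b i)
    (h_disj : Pairwise fun i j => b i ≤ a j ∨ b j ≤ a i) :
    iIndepFun (fun i ω => innovation θ v (Z · ω) (a i) (b i)) P := by
  have := Fintype.ofFinite ι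
  refine HasGaussianLaw.iIndepFun_of_covariance_eq_zero ?_ fun i j hij => ?_
  · let restrictUniv : (↥(Finset.univ : Finset ι) → ℝ) →L[ℝ] (ι → ℝ) :=
      ContinuousLinearMap.pi fun i => ContinuousLinearMap.proj ⟨i, Finset.mem_univ i⟩
    exact ((hZ.isGaussianProcess_innovation.comp_right fun i => (a i, b i)).hasGaussianLaw
      Finset.univ).map restrictUniv
  · rcases h_disj hij with h | h
    · exact hZ.covariance_innovation_innovation_of_le (hab i) h (hab j)
    · rw [covariance_comm]
      exact hZ.covariance_innovation_innovation_of_le (hab j) h (hab i)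

end IsStationaryOU

end OrnsteinUhlenbeck

section WeightedPairs

variable {α : Type*} {n : ℕ}

/-- The sum of `f` over the pairs of sites whose indices differ by `k`, the earlier site being the
first argument of `f`. -/
def lagSum (s : Fin n → α) (k : ℕ) (f : α → α → ℝ) : ℝ :=
  ∑ i : Fin (n - k), f (s (i.castLE (n.sub_le k))) (s ⟨i + k, Nat.add_lt_of_lt_sub i.2⟩)

/-- The average of `f` over the pairs of sites with increasing indices, a pair at lag `k` having
weight `w k`. It is a linear functional of `f`, and is `0` if all the weights vanish. -/
noncomputable def pairMean (w : ℕ → ℝ) (s : Fin n → α) : (α → α → ℝ) →ₗ[ℝ] ℝ where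
  toFun f := (∑ p : Fin n × Fin n with p.1 < p.2, w (p.2 - p.1) * f (s p.1) (s p.2)) /
    ∑ p : Fin n × Fin n with p.1 < p.2, w (p.2 - p.1)
  map_add' f g := by
    simp only [Pi.add_apply, mul_add, Finset.sum_add_distrib, add_div]
  map_smul' c f := by
    simp only [Pi.smul_apply, smul_eq_mul, mul_left_comm _ c, ← Finset.mul_sum, mul_div_assoc,
      RingHom.id_apply]

/-- A nonzero sequence of nonnegative weights, indexed by the positive lags, of range at most
`K`. -/
structure IsLagWeight (w : ℕ → ℝ) (K : ℕ) : Prop where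
  nonneg : ∀ k, 1 ≤ k → 0 ≤ w k
  exists_ne_zero : ∃ k, 1 ≤ k ∧ w k ≠ 0
  eq_zero_of_lt : ∀ k, K < k → w k = 0

lemma exists_isLagWeight {w : ℕ → ℝ} (hw_nonneg : ∀ k, 1 ≤ k → 0 ≤ w k)
    (hw_ne : ∃ k, 1 ≤ k ∧ w k ≠ 0) (hw_fin : {k | 1 ≤ k ∧ w k ≠ 0}.Finite) :
    ∃ K, IsLagWeight w K := by
  obtain ⟨K, hK⟩ := hw_fin.bddAbove
  exact ⟨K, hw_nonneg, hw_ne, fun k hk => by_contra fun h =>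
    hk.not_ge (hK ⟨Nat.one_le_of_lt hk, h⟩)⟩

lemma sum_filter_add_eq_eq_lagSum (s : Fin n → α) (f : α → α → ℝ) (k : ℕ) :
    ∑ p : Fin n × Fin n with (p.1 : ℕ) + k = p.2, f (s p.1) (s p.2) = lagSum s k f := by
  symm
  refine Finset.sum_nbij
    (fun i : Fin (n - k) => (i.castLE (n.sub_le k), ⟨i + k, Nat.add_lt_of_lt_sub i.2⟩))
    (fun i _ => by simp) (fun i _ j _ hij => ?_) (fun p hp => ?_) fun i _ => rfl
  · simpa using congrArg Prod.fst hij
  · have hp' : (p.1 : ℕ) + k = p.2 := by simpa using hp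
    refine ⟨⟨p.1, by omega⟩, by simp, Prod.ext rfl (Fin.ext ?_)⟩
    exact hp'

variable {w : ℕ → ℝ} {K : ℕ}

namespace IsLagWeight

lemma weight_nonneg (hw : IsLagWeight w K) {i j : Fin n} (hij : i < j) : 0 ≤ w (j - i) :=
  hw.nonneg _ (Nat.sub_pos_of_lt hij)

lemma sum_pos (hw : IsLagWeight w K) : 0 < ∑ k ∈ Finset.Icc 1 K, w k := by
  obtain ⟨k, hk, hwk⟩ := hw.exists_ne_zero
  have hkK : k ≤ K := not_lt.1 fun h => hwk (hw.eq_zero_of_lt k h)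
  exact Finset.sum_pos' (fun i hi => hw.nonneg i (Finset.mem_Icc.1 hi).1)
    ⟨k, Finset.mem_Icc.2 ⟨hk, hkK⟩, (hw.nonneg k hk).lt_of_ne' hwk⟩

lemma sum_pairs_eq_sum_lagSum (hw : IsLagWeight w K) (s : Fin n → α) (f : α → α → ℝ) :
    ∑ p : Fin n × Fin n with p.1 < p.2, w (p.2 - p.1) * f (s p.1) (s p.2) =
      ∑ k ∈ Finset.Icc 1 K, w k * lagSum s k f := by
  have h_term (p : Fin n × Fin n) :
      ∑ k ∈ Finset.Icc 1 K, (if (p.1 : ℕ) + k = p.2 then w k * f (s p.1) (s p.2) else 0) =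
        if p.1 < p.2 then w (p.2 - p.1) * f (s p.1) (s p.2) else 0 := by
    have h_iff (k : ℕ) (hk : k ∈ Finset.Icc 1 K) :
        (p.1 : ℕ) + k = p.2 ↔ ((p.2 : ℕ) - p.1 : ℕ) = k := by
      have := (Finset.mem_Icc.1 hk).1
      omega
    rw [Finset.sum_congr rfl fun k hk => if_congr (h_iff k hk) rfl rfl, Finset.sum_ite_eq]
    split_ifs with h_mem h_lt h_lt
    · rfl
    · have := (Finset.mem_Icc.1 h_mem).1
      omega
    · have : K < p.2 - p.1 := by
        rw [Finset.mem_Icc] at h_mem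
        omega
      rw [hw.eq_zero_of_lt _ this, zero_mul]
    · rfl
  simp only [Finset.sum_filter, ← h_term]
  rw [Finset.sum_comm]
  simp only [← Finset.sum_filter, ← Finset.mul_sum, sum_filter_add_eq_eq_lagSum]

lemma pairMean_eq_div (hw : IsLagWeight w K) (s : Fin n → α) (f : α → α → ℝ) :
    pairMean w s f = (∑ k ∈ Finset.Icc 1 K, w k * lagSum s k f) /
      ∑ k ∈ Finset.Icc 1 K, w k * lagSum s k 1 := by
  rw [← hw.sum_pairs_eq_sum_lagSum, ← hw.sum_pairs_eq_sum_lagSum]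
  simp only [pairMean, LinearMap.coe_mk, AddHom.coe_mk, Pi.one_apply, mul_one]

lemma pairMean_mono (hw : IsLagWeight w K) {s : Fin n → α} {f g : α → α → ℝ}
    (hfg : ∀ i j, i < j → f (s i) (s j) ≤ g (s i) (s j)) : pairMean w s f ≤ pairMean w s g := by
  refine div_le_div_of_nonneg_right (Finset.sum_le_sum fun p hp => ?_)
    (Finset.sum_nonneg fun p hp => ?_)
  · exact mul_le_mul_of_nonneg_left (hfg _ _ (Finset.mem_filter.1 hp).2)
      (hw.weight_nonneg (Finset.mem_filter.1 hp).2)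
  · exact hw.weight_nonneg (Finset.mem_filter.1 hp).2

lemma pairMean_nonneg (hw : IsLagWeight w K) {s : Fin n → α} {f : α → α → ℝ}
    (hf : ∀ i j, i < j → 0 ≤ f (s i) (s j)) : 0 ≤ pairMean w s f := by
  simpa only [map_zero] using hw.pairMean_mono (f := 0) hf

lemma sq_pairMean_mul_le (hw : IsLagWeight w K) (s : Fin n → α) (f g : α → α → ℝ) :
    pairMean w s (f * g) ^ 2 ≤ pairMean w s (f ^ 2) * pairMean w s (g ^ 2) := by
  simp only [pairMean, LinearMap.coe_mk, AddHom.coe_mk, div_pow, div_mul_div_comm, ← sq,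
    Pi.mul_apply, Pi.pow_apply]
  gcongr
  refine Finset.sum_sq_le_sum_mul_sum_of_sq_le_mul _ (fun p hp => ?_) (fun p hp => ?_)
    fun p _ => le_of_eq (by ring)
  · exact mul_nonneg (hw.weight_nonneg (Finset.mem_filter.1 hp).2) (sq_nonneg _)
  · exact mul_nonneg (hw.weight_nonneg (Finset.mem_filter.1 hp).2) (sq_nonneg _)

end IsLagWeight

lemma tendsto_natCast_sub_div (k : ℕ) :
    Tendsto (fun n : ℕ => ((n - k : ℕ) : ℝ) / n) atTop (𝓝 1) := by
  have h_lim : Tendsto (fun n : ℕ => 1 - (k : ℝ) / n) atTop (𝓝 1) := by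
    simpa using tendsto_const_nhds.sub (tendsto_const_div_atTop_nhds_zero_nat (k : ℝ))
  refine h_lim.congr' ?_
  filter_upwards [eventually_ge_atTop k, eventually_gt_atTop 0] with n hkn hn
  rw [Nat.cast_sub hkn, sub_div, div_self (by positivity)]

lemma lagSum_one (s : Fin n → α) (k : ℕ) : lagSum s k 1 = (n - k : ℕ) := by
  simp only [lagSum, Pi.one_apply, Finset.sum_const, Finset.card_univ, Fintype.card_fin,
    nsmul_eq_mul, mul_one]

namespace IsLagWeight

variable {s : (n : ℕ) → Fin n → α} {f g : α → α → ℝ}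

lemma tendsto_pairMean_of_lagSum (hw : IsLagWeight w K) {L : ℝ}
    (h : ∀ k, 1 ≤ k → Tendsto (fun n : ℕ => lagSum (s n) k f / n) atTop (𝓝 L)) :
    Tendsto (fun n => pairMean w (s n) f) atTop (𝓝 L) := by
  have h_sum {g : α → α → ℝ} {M : ℝ}
      (hg : ∀ k, 1 ≤ k → Tendsto (fun n : ℕ => lagSum (s n) k g / n) atTop (𝓝 M)) :
      Tendsto (fun n : ℕ => (∑ k ∈ Finset.Icc 1 K, w k * lagSum (s n) k g) / n) atTop
        (𝓝 ((∑ k ∈ Finset.Icc 1 K, w k) * M)) := by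
    simp only [Finset.sum_div, Finset.sum_mul, mul_div_assoc]
    exact tendsto_finsetSum _ fun k hk => (hg k (Finset.mem_Icc.1 hk).1).const_mul _
  have h_one (k : ℕ) : Tendsto (fun n : ℕ => lagSum (s n) k 1 / n) atTop (𝓝 1) := by
    simpa only [lagSum_one] using tendsto_natCast_sub_div k
  have h_div := (h_sum h).div (h_sum fun k _ => h_one k) (by simpa using hw.sum_pos.ne')
  rw [mul_one, mul_div_cancel_left₀ _ hw.sum_pos.ne'] at h_div
  refine h_div.congr' ?_
  filter_upwards [eventually_gt_atTop 0] with n hn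
  rw [Pi.div_apply, div_div_div_cancel_right₀ (by positivity), hw.pairMean_eq_div]

lemma eventually_pairMean_one (hw : IsLagWeight w K) (s : (n : ℕ) → Fin n → α) :
    ∀ᶠ n in atTop, pairMean w (s n) 1 = 1 := by
  have h_lim : Tendsto (fun n => pairMean w (s n) 1) atTop (𝓝 1) :=
    hw.tendsto_pairMean_of_lagSum fun k _ => by
      simpa only [lagSum_one] using tendsto_natCast_sub_div k
  filter_upwards [h_lim.eventually_ne one_ne_zero] with n hn
  rw [hw.pairMean_eq_div] at hn ⊢
  exact div_self (div_ne_zero_iff.1 hn).2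

lemma tendsto_pairMean_mul_zero (hw : IsLagWeight w K)
    (hf : Tendsto (fun n => pairMean w (s n) (f ^ 2)) atTop (𝓝 0)) {L : ℝ}
    (hg : Tendsto (fun n => pairMean w (s n) (g ^ 2)) atTop (𝓝 L)) :
    Tendsto (fun n => pairMean w (s n) (f * g)) atTop (𝓝 0) := by
  have h_prod := hf.mul hg
  rw [zero_mul] at h_prod
  have h_sq : Tendsto (fun n => pairMean w (s n) (f * g) ^ 2) atTop (𝓝 0) :=
    squeeze_zero (fun n => sq_nonneg _) (fun n => hw.sq_pairMean_mul_le (s n) f g) h_prod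
  rw [tendsto_zero_iff_abs_tendsto_zero]
  simpa only [Function.comp_def, Real.sqrt_sq_eq_abs, Real.sqrt_zero] using h_sq.sqrt

/-- An `L²` perturbation argument: `f ^ 2 = g ^ 2 + 2 (f - g) g + (f - g) ^ 2`. -/
lemma tendsto_pairMean_sq_of_sub (hw : IsLagWeight w K) {L : ℝ}
    (hg : Tendsto (fun n => pairMean w (s n) (g ^ 2)) atTop (𝓝 L))
    (hfg : Tendsto (fun n => pairMean w (s n) ((f - g) ^ 2)) atTop (𝓝 0)) :
    Tendsto (fun n => pairMean w (s n) (f ^ 2)) atTop (𝓝 L) := by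
  have h_expand : f ^ 2 = g ^ 2 + (2 : ℝ) • ((f - g) * g) + (f - g) ^ 2 := by
    ext a b
    simp only [Pi.add_apply, Pi.pow_apply, Pi.smul_apply, Pi.mul_apply, Pi.sub_apply, smul_eq_mul]
    ring
  have h_lim := (hg.add ((hw.tendsto_pairMean_mul_zero hfg hg).const_mul 2)).add hfg
  simpa only [h_expand, map_add, map_smul, smul_eq_mul, mul_zero, add_zero] using h_lim

end IsLagWeight

end WeightedPairs

section Sites

/-- The signed distance from the site `s` to the site `t`. -/
def gap (s t : unitInterval) : ℝ := t - s

lemma gap_nonneg {s t : unitInterval} (hst : s ≤ t) : 0 ≤ gap s t :=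
  sub_nonneg.2 hst

lemma gap_pos {s t : unitInterval} (hst : s < t) : 0 < gap s t :=
  sub_pos.2 hst

lemma gap_le_one (s t : unitInterval) : gap s t ≤ 1 := by
  linarith [t.2.2, s.2.1, show gap s t = t - s from rfl]

lemma lagSum_gap_le {n : ℕ} (s : Fin n → unitInterval) (k : ℕ) : lagSum s k gap ≤ k := by
  let u (i : ℕ) : ℝ := if h : i < n then s ⟨i, h⟩ else 0
  have hu_nonneg (i : ℕ) : 0 ≤ u i := by
    by_cases h : i < n
    · simpa only [u, h, dif_pos] using (s ⟨i, h⟩).2.1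
    · simp only [u, h, dif_neg, not_false_eq_true, le_refl]
  have hu_le_one (i : ℕ) : u i ≤ 1 := by
    by_cases h : i < n
    · simpa only [u, h, dif_pos] using (s ⟨i, h⟩).2.2
    · simp only [u, h, dif_neg, not_false_eq_true, zero_le_one]
  have h_lagSum : lagSum s k gap = ∑ i ∈ Finset.range (n - k), (u (i + k) - u i) := by
    rw [lagSum, Finset.sum_range]
    refine Finset.sum_congr rfl fun i _ => ?_
    have hi : (i : ℕ) + k < n := Nat.add_lt_of_lt_sub i.2
    have hi' : (i : ℕ) < n := by omega
    simp only [u, hi, hi', dif_pos]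
    rfl
  have h_swap : ∑ i ∈ Finset.range (n - k), (u (i + k) - u i) =
      ∑ i ∈ Finset.range k, (u (n - k + i) - u i) := by
    have h₁ := Finset.sum_range_add u (n - k) k
    have h₂ := Finset.sum_range_add u k (n - k)
    simp only [Finset.sum_sub_distrib, add_comm _ k] at h₁ h₂ ⊢
    linarith
  calc lagSum s k gap = ∑ i ∈ Finset.range k, (u (n - k + i) - u i) := h_lagSum.trans h_swap
    _ ≤ ∑ _i ∈ Finset.range k, (1 : ℝ) :=
        Finset.sum_le_sum fun i _ => by linarith [hu_nonneg i, hu_le_one (n - k + i)]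
    _ = k := by simp

variable {w : ℕ → ℝ} {K : ℕ} {s : (n : ℕ) → Fin n → unitInterval}
  {f : unitInterval → unitInterval → ℝ}

lemma IsLagWeight.tendsto_pairMean_gap_mul (hw : IsLagWeight w K) (hs : ∀ n, Monotone (s n))
    (hf_nonneg : ∀ a b, 0 ≤ f a b)
    (hf_le : ∀ ε > 0, ∀ᶠ n in atTop, ∀ i j, i < j → f (s n i) (s n j) ≤ ε * n) :
    Tendsto (fun n => pairMean w (s n) (gap * f)) atTop (𝓝 0) := by
  refine hw.tendsto_pairMean_of_lagSum fun k hk => ?_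
  have h_lt {n : ℕ} (i : Fin (n - k)) :
      i.castLE (n.sub_le k) < ⟨i + k, Nat.add_lt_of_lt_sub i.2⟩ :=
    Fin.lt_def.2 (Nat.lt_add_of_pos_right hk)
  have h_nonneg (n : ℕ) : 0 ≤ lagSum (s n) k (gap * f) :=
    Finset.sum_nonneg fun i _ => mul_nonneg (gap_nonneg (hs n (h_lt i).le)) (hf_nonneg _ _)
  refine Metric.tendsto_nhds.2 fun ε hε => ?_
  have hε' : 0 < ε / (k + 1) := by positivity
  filter_upwards [hf_le _ hε', eventually_gt_atTop 0] with n hn hn_pos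
  have hn_pos' : (0 : ℝ) < n := by exact_mod_cast hn_pos
  rw [Real.dist_eq, sub_zero, abs_of_nonneg (div_nonneg (h_nonneg n) n.cast_nonneg),
    div_lt_iff₀ hn_pos']
  calc lagSum (s n) k (gap * f) ≤ lagSum (s n) k gap * (ε / (k + 1) * n) := by
        simp only [lagSum, Finset.sum_mul, Pi.mul_apply]
        exact Finset.sum_le_sum fun i _ =>
          mul_le_mul_of_nonneg_left (hn _ _ (h_lt i)) (gap_nonneg (hs n (h_lt i).le))
    _ ≤ k * (ε / (k + 1) * n) := by gcongr; exact lagSum_gap_le _ _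
    _ < (k + 1) * (ε / (k + 1) * n) := by gcongr; exact lt_add_one _
    _ = ε * n := by field_simp

lemma IsLagWeight.tendsto_pairMean_gap (hw : IsLagWeight w K) (hs : ∀ n, Monotone (s n)) :
    Tendsto (fun n => pairMean w (s n) gap) atTop (𝓝 0) := by
  have h_one (ε : ℝ) (hε : 0 < ε) : ∀ᶠ n : ℕ in atTop, 1 ≤ ε * n :=
    (tendsto_natCast_atTop_atTop.const_mul_atTop hε).eventually_ge_atTop 1
  simpa only [mul_one] using hw.tendsto_pairMean_gap_mul (f := 1) hs (fun _ _ => zero_le_one)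
    fun ε hε => (h_one ε hε).mono fun n hn _ _ _ => hn

end Sites

section TypicalPaths

/-- The almost sure properties of the observed path from which consistency is deduced: the squared
observations and innovations are `o(n)`, uniformly in the sites, and the squared innovations obey
the law of large numbers. -/
structure IsTypicalPath (w : ℕ → ℝ) (θ v : ℝ) (s : (n : ℕ) → Fin n → unitInterval)
    (z : unitInterval → ℝ) : Prop where
  sq_le : ∀ ε > 0, ∀ᶠ n : ℕ in atTop, ∀ i, z (s n i) ^ 2 ≤ ε * n
  innovation_sq_le : ∀ ε > 0, ∀ᶠ n in atTop, ∀ i j, i < j →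
    innovation θ v z (s n i) (s n j) ^ 2 ≤ ε * n
  tendsto_pairMean : Tendsto (fun n => pairMean w (s n) (innovation θ v z ^ 2)) atTop (𝓝 1)

variable {Ω : Type*} [MeasurableSpace Ω] {P : Measure Ω} {Z : unitInterval → Ω → ℝ} {θ v : ℝ}
  {s : (n : ℕ) → Fin n → unitInterval}

namespace IsStationaryOU

lemma ae_eventually_sq_le [IsFiniteMeasure P] (hZ : IsStationaryOU P Z θ v) (hv : 0 < v)
    (s : (n : ℕ) → Fin n → unitInterval) :
    ∀ᵐ ω ∂P, ∀ ε > 0, ∀ᶠ n : ℕ in atTop, ∀ i, Z (s n i) ω ^ 2 ≤ ε * n := by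
  filter_upwards [ae_eventually_forall_sq_le (p := 1) (by simp)
    fun n i => hZ.hasLaw_div_sqrt hv (s n i)] with ω hω ε hε
  filter_upwards [hω (ε / v) (div_pos hε hv)] with n hn i
  have h := hn i
  rwa [div_pow, Real.sq_sqrt hv.le, div_mul_eq_mul_div, div_le_div_iff_of_pos_right hv] at h

lemma ae_eventually_innovation_sq_le [IsFiniteMeasure P] (hZ : IsStationaryOU P Z θ v)
    (hθ : 0 < θ) (hv : 0 < v) (hs : ∀ n, StrictMono (s n)) :
    ∀ᵐ ω ∂P, ∀ ε > 0, ∀ᶠ n in atTop, ∀ i j, i < j →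
      innovation θ v (Z · ω) (s n i) (s n j) ^ 2 ≤ ε * n := by
  have h_card (n : ℕ) : Fintype.card {p : Fin n × Fin n // p.1 < p.2} ≤ n ^ 2 := by
    simpa only [Fintype.card_prod, Fintype.card_fin, sq] using
      Fintype.card_subtype_le fun p : Fin n × Fin n => p.1 < p.2
  filter_upwards [ae_eventually_forall_sq_le h_card
    fun n p => hZ.hasLaw_innovation hθ hv (hs n p.2)] with ω hω ε hε
  exact (hω ε hε).mono fun n hn i j hij => hn ⟨(i, j), hij⟩

/-- Pairs at lag `k` whose indices agree modulo `k` span intervals with disjoint interiors, over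
which the innovations are independent. -/
lemma ae_tendsto_sum_innovation_sq_sub_one [IsProbabilityMeasure P]
    (hZ : IsStationaryOU P Z θ v) (hθ : 0 < θ) (hv : 0 < v) (hs : ∀ n, StrictMono (s n)) {k : ℕ}
    (hk : 1 ≤ k) (r : ZMod k) :
    ∀ᵐ ω ∂P, Tendsto (fun n : ℕ => (∑ i : {i : Fin (n - k) // ((i : ℕ) : ZMod k) = r},
      (innovation θ v (Z · ω) (s n (i.1.castLE (n.sub_le k)))
        (s n ⟨i.1 + k, Nat.add_lt_of_lt_sub i.1.2⟩) ^ 2 - 1)) / (n : ℝ)) atTop (𝓝 0) := by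
  have h_lt {n : ℕ} (i : Fin (n - k)) :
      s n (i.castLE (n.sub_le k)) < s n ⟨i + k, Nat.add_lt_of_lt_sub i.2⟩ :=
    hs n (Fin.lt_def.2 (Nat.lt_add_of_pos_right hk))
  have h_le {n : ℕ} {i j : {i : Fin (n - k) // ((i : ℕ) : ZMod k) = r}} (hij : i.1 < j.1) :
      s n ⟨i.1 + k, Nat.add_lt_of_lt_sub i.1.2⟩ ≤ s n (j.1.castLE (n.sub_le k)) := by
    have h_mod : (i : ℕ) ≡ j [MOD k] := (ZMod.natCast_eq_natCast_iff _ _ _).1 (i.2.trans j.2.symm)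
    have h_sub := Nat.le_of_dvd (Nat.sub_pos_of_lt hij) ((Nat.modEq_iff_dvd' hij.le).1 h_mod)
    refine (hs n).monotone (Fin.le_def.2 ?_)
    change (i : ℕ) + k ≤ j
    have : (i : ℕ) < j := hij
    omega
  refine ae_tendsto_sum_div_of_iIndepFun (fun n => ?_) (fun n => ?_) (by norm_num) (by norm_num)
    fun n i => hasSubexponentialMGF_sq_sub_one (hZ.hasLaw_innovation hθ hv (h_lt i.1))
  · exact (Fintype.card_subtype_le _).trans (by simp)
  · refine (hZ.iIndepFun_innovation (ι := {i : Fin (n - k) // ((i : ℕ) : ZMod k) = r})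
      (fun i => (h_lt i.1).le) fun i j hij => ?_).comp
      (fun _ x => x ^ 2 - 1) fun _ => by fun_prop
    exact (lt_or_gt_of_ne fun h => hij (Subtype.ext h)).imp h_le h_le

lemma ae_tendsto_lagSum_innovation_sq [IsProbabilityMeasure P] (hZ : IsStationaryOU P Z θ v)
    (hθ : 0 < θ) (hv : 0 < v) (hs : ∀ n, StrictMono (s n)) {k : ℕ} (hk : 1 ≤ k) :
    ∀ᵐ ω ∂P, Tendsto (fun n : ℕ => lagSum (s n) k (innovation θ v (Z · ω) ^ 2) / n)
      atTop (𝓝 1) := by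
  have : NeZero k := ⟨Nat.ne_of_gt hk⟩
  filter_upwards [ae_all_iff.2 (hZ.ae_tendsto_sum_innovation_sq_sub_one hθ hv hs hk)] with ω hω
  have h_lim := (tendsto_finsetSum Finset.univ fun r _ => hω r).add (tendsto_natCast_sub_div k)
  rw [Finset.sum_const_zero, zero_add] at h_lim
  refine h_lim.congr fun n => ?_
  rw [← Finset.sum_div, ← add_div]
  congr 1
  rw [Fintype.sum_fiberwise (fun i : Fin (n - k) => ((i : ℕ) : ZMod k)) fun i =>
    innovation θ v (Z · ω) (s n (i.castLE (n.sub_le k)))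
      (s n ⟨i + k, Nat.add_lt_of_lt_sub i.2⟩) ^ 2 - 1, ← lagSum_one (s n), lagSum, lagSum,
    ← Finset.sum_add_distrib]
  simp only [Pi.one_apply, Pi.pow_apply, sub_add_cancel]

theorem ae_isTypicalPath [IsProbabilityMeasure P] (hZ : IsStationaryOU P Z θ v) (hθ : 0 < θ)
    (hv : 0 < v) (hs : ∀ n, StrictMono (s n)) {w : ℕ → ℝ} {K : ℕ} (hw : IsLagWeight w K) :
    ∀ᵐ ω ∂P, IsTypicalPath w θ v s (Z · ω) := by
  have h_lag (k : ℕ) : ∀ᵐ ω ∂P, 1 ≤ k →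
      Tendsto (fun n : ℕ => lagSum (s n) k (innovation θ v (Z · ω) ^ 2) / n) atTop (𝓝 1) :=
    eventually_imp_distrib_left.2 fun hk => hZ.ae_tendsto_lagSum_innovation_sq hθ hv hs hk
  filter_upwards [hZ.ae_eventually_sq_le hv s, hZ.ae_eventually_innovation_sq_le hθ hv hs,
    ae_all_iff.2 h_lag] with ω h_sq h_innovation h_lagSum
  exact ⟨h_sq, h_innovation, hw.tendsto_pairMean_of_lagSum h_lagSum⟩

end IsStationaryOU

end TypicalPaths

section Increments

lemma one_sub_exp_neg_two_mul_le (u : ℝ) : 1 - Real.exp (-(2 * u)) ≤ 2 * u := by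
  linarith [Real.add_one_le_exp (-(2 * u))]

lemma two_mul_exp_neg_mul_sinh (u : ℝ) :
    2 * (Real.exp (-u) * Real.sinh u) = 1 - Real.exp (-(2 * u)) := by
  have h_one : Real.exp (-u) * Real.exp u = 1 := by
    rw [← Real.exp_add, neg_add_cancel, Real.exp_zero]
  have h_sq : Real.exp (-(2 * u)) = Real.exp (-u) * Real.exp (-u) := by
    rw [← Real.exp_add]
    ring_nf
  rw [Real.sinh_eq, h_sq]
  linear_combination h_one

lemma two_mul_exp_neg_mul_le {u : ℝ} (hu : 0 ≤ u) :
    2 * u * Real.exp (-u) ≤ 1 - Real.exp (-(2 * u)) := by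
  rw [← two_mul_exp_neg_mul_sinh]
  nlinarith [Real.self_le_sinh_iff.2 hu, Real.exp_pos (-u)]

lemma sq_one_sub_exp_neg_le {u : ℝ} (hu : 0 ≤ u) : (1 - Real.exp (-u)) ^ 2 ≤ u ^ 2 :=
  pow_le_pow_left₀ (sub_nonneg.2 (Real.exp_le_one_iff.2 (neg_nonpos.2 hu)))
    (by linarith [Real.one_sub_le_exp_neg u]) 2

lemma sq_one_sub_sqrt_div_le {u : ℝ} (hu : 0 < u) :
    (1 - √((1 - Real.exp (-(2 * u))) / (2 * u))) ^ 2 ≤ u := by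
  set q := (1 - Real.exp (-(2 * u))) / (2 * u) with hq
  have h_ge : 1 - u ≤ q := by
    rw [hq, le_div_iff₀ (by positivity)]
    nlinarith [two_mul_exp_neg_mul_le hu.le, Real.one_sub_le_exp_neg u]
  have hq_nonneg : 0 ≤ q :=
    div_nonneg (sub_nonneg.2 (Real.exp_le_one_iff.2 (by linarith))) (by positivity)
  have h_le_one : √q ≤ 1 :=
    Real.sqrt_le_one.2 ((div_le_one (by positivity)).2 (one_sub_exp_neg_two_mul_le u))
  nlinarith [Real.sq_sqrt hq_nonneg, Real.sqrt_nonneg q]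

/-- The increment of the path `z` between the times `s < t`, divided by the leading order as
`t - s → 0` of its standard deviation when the product of the scale and variance parameters
is `G`. -/
noncomputable def scaledIncrement (G : ℝ) (z : unitInterval → ℝ) (s t : unitInterval) : ℝ :=
  (z t - z s) / √(2 * G * gap s t)

/-- The sum of the squared observations at two sites. -/
def sqSum (z : unitInterval → ℝ) (s t : unitInterval) : ℝ :=
  z s ^ 2 + z t ^ 2

lemma sq_scaledIncrement_sub_innovation_le {θ v : ℝ} (hθ : 0 < θ) (hv : 0 < v)
    (z : unitInterval → ℝ) {s t : unitInterval} (hst : s < t) :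
    (scaledIncrement (θ * v) z s t - innovation θ v z s t) ^ 2 ≤
      2 * θ * (gap s t * innovation θ v z s t ^ 2) + θ / v * (gap s t * sqSum z s t) := by
  have h_gap := gap_pos hst
  set u := θ * gap s t with hu_def
  have hu : 0 < u := mul_pos hθ h_gap
  have h_exp_lt : Real.exp (-(2 * u)) < 1 := Real.exp_lt_one_iff.2 (by linarith)
  set M := √(2 * (θ * v) * gap s t) with hM
  set N := √(v * (1 - Real.exp (-(2 * u)))) with hN
  have hM_pos : 0 < M := by positivity
  have hN_pos : 0 < N := Real.sqrt_pos.2 (mul_pos hv (sub_pos.2 h_exp_lt))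
  have hM_sq : M ^ 2 = 2 * v * u := by rw [hM, Real.sq_sqrt (by positivity), hu_def]; ring
  have h_ratio : N / M = √((1 - Real.exp (-(2 * u))) / (2 * u)) := by
    rw [hN, hM, ← Real.sqrt_div' _ (by positivity), hu_def]
    congr 1
    field_simp
  have h_innovation : innovation θ v z s t = (z t - Real.exp (-u) * z s) / N := by
    rw [innovation, hN, hu_def, gap]
    ring_nf
  have h_sub : scaledIncrement (θ * v) z s t - innovation θ v z s t =
      -((1 - N / M) * innovation θ v z s t + (1 - Real.exp (-u)) / M * z s) := by
    rw [h_innovation, scaledIncrement, ← hM]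
    field_simp
    ring
  have h_drift : ((1 - Real.exp (-u)) / M) ^ 2 ≤ u / (2 * v) := by
    rw [div_pow, hM_sq, div_le_div_iff₀ (by positivity) (by positivity)]
    nlinarith [sq_one_sub_exp_neg_le hu.le]
  calc (scaledIncrement (θ * v) z s t - innovation θ v z s t) ^ 2
      ≤ 2 * (((1 - N / M) * innovation θ v z s t) ^ 2 +
          ((1 - Real.exp (-u)) / M * z s) ^ 2) := by
        rw [h_sub, neg_sq]
        exact add_sq_le
    _ ≤ 2 * (u * innovation θ v z s t ^ 2 + u / (2 * v) * sqSum z s t) := by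
        rw [mul_pow, mul_pow, h_ratio]
        gcongr
        · exact sq_one_sub_sqrt_div_le hu
        · exact le_add_of_nonneg_right (sq_nonneg _)
    _ = _ := by
        rw [hu_def]
        field_simp

lemma gap_mul_sq_scaledIncrement_le {s t : unitInterval} (hst : s ≤ t) (G θ v : ℝ)
    (z : unitInterval → ℝ) :
    gap s t * scaledIncrement G z s t ^ 2 ≤ 2 * (gap s t * innovation θ v z s t ^ 2) +
      2 * (scaledIncrement G z s t - innovation θ v z s t) ^ 2 := by
  have h_sq : scaledIncrement G z s t ^ 2 ≤
      2 * (innovation θ v z s t ^ 2 + (scaledIncrement G z s t - innovation θ v z s t) ^ 2) := by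
    simpa using add_sq_le (a := innovation θ v z s t)
      (b := scaledIncrement G z s t - innovation θ v z s t)
  nlinarith [mul_le_mul_of_nonneg_left h_sq (gap_nonneg hst),
    mul_le_mul_of_nonneg_right (gap_le_one s t)
      (sq_nonneg (scaledIncrement G z s t - innovation θ v z s t))]

end Increments

namespace IsTypicalPath

variable {w : ℕ → ℝ} {K : ℕ} {θ v : ℝ} {s : (n : ℕ) → Fin n → unitInterval}
  {z : unitInterval → ℝ}

lemma tendsto_pairMean_gap_mul_innovation_sq (h : IsTypicalPath w θ v s z)
    (hw : IsLagWeight w K) (hs : ∀ n, StrictMono (s n)) :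
    Tendsto (fun n => pairMean w (s n) (gap * innovation θ v z ^ 2)) atTop (𝓝 0) :=
  hw.tendsto_pairMean_gap_mul (fun n => (hs n).monotone) (fun _ _ => sq_nonneg _)
    h.innovation_sq_le

lemma tendsto_pairMean_gap_mul_sqSum (h : IsTypicalPath w θ v s z) (hw : IsLagWeight w K)
    (hs : ∀ n, StrictMono (s n)) :
    Tendsto (fun n => pairMean w (s n) (gap * sqSum z)) atTop (𝓝 0) := by
  refine hw.tendsto_pairMean_gap_mul (fun n => (hs n).monotone)
    (fun _ _ => add_nonneg (sq_nonneg _) (sq_nonneg _)) fun ε hε => ?_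
  filter_upwards [h.sq_le (ε / 2) (half_pos hε)] with n hn i j _
  rw [sqSum]
  linarith [hn i, hn j]

lemma tendsto_pairMean_scaledIncrement_sub_innovation_sq (h : IsTypicalPath w θ v s z)
    (hw : IsLagWeight w K) (hs : ∀ n, StrictMono (s n)) (hθ : 0 < θ) (hv : 0 < v) :
    Tendsto (fun n => pairMean w (s n) ((scaledIncrement (θ * v) z - innovation θ v z) ^ 2))
      atTop (𝓝 0) := by
  have h_bound : Tendsto (fun n => pairMean w (s n)
      ((2 * θ) • (gap * innovation θ v z ^ 2) + (θ / v) • (gap * sqSum z))) atTop (𝓝 0) := by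
    simpa only [map_add, map_smul, smul_eq_mul, mul_zero, add_zero] using
      ((h.tendsto_pairMean_gap_mul_innovation_sq hw hs).const_mul (2 * θ)).add
        ((h.tendsto_pairMean_gap_mul_sqSum hw hs).const_mul (θ / v))
  exact squeeze_zero (fun n => hw.pairMean_nonneg fun i j _ => sq_nonneg _)
    (fun n => hw.pairMean_mono fun i j hij =>
      sq_scaledIncrement_sub_innovation_le hθ hv z (hs n hij)) h_bound

lemma tendsto_pairMean_scaledIncrement_sq (h : IsTypicalPath w θ v s z)
    (hw : IsLagWeight w K) (hs : ∀ n, StrictMono (s n)) (hθ : 0 < θ) (hv : 0 < v) :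
    Tendsto (fun n => pairMean w (s n) (scaledIncrement (θ * v) z ^ 2)) atTop (𝓝 1) :=
  hw.tendsto_pairMean_sq_of_sub h.tendsto_pairMean
    (h.tendsto_pairMean_scaledIncrement_sub_innovation_sq hw hs hθ hv)

lemma tendsto_pairMean_gap_mul_scaledIncrement_sq (h : IsTypicalPath w θ v s z)
    (hw : IsLagWeight w K) (hs : ∀ n, StrictMono (s n)) (hθ : 0 < θ) (hv : 0 < v) :
    Tendsto (fun n => pairMean w (s n) (gap * scaledIncrement (θ * v) z ^ 2)) atTop (𝓝 0) := by
  have h_bound : Tendsto (fun n => pairMean w (s n) ((2 : ℝ) • (gap * innovation θ v z ^ 2) +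
      (2 : ℝ) • (scaledIncrement (θ * v) z - innovation θ v z) ^ 2)) atTop (𝓝 0) := by
    simpa only [map_add, map_smul, smul_eq_mul, mul_zero, add_zero] using
      ((h.tendsto_pairMean_gap_mul_innovation_sq hw hs).const_mul 2).add
        ((h.tendsto_pairMean_scaledIncrement_sub_innovation_sq hw hs hθ hv).const_mul 2)
  exact squeeze_zero
    (fun n => hw.pairMean_nonneg fun i j hij =>
      mul_nonneg (gap_nonneg (hs n hij).le) (sq_nonneg _))
    (fun n => hw.pairMean_mono fun i j hij =>
      gap_mul_sq_scaledIncrement_le (hs n hij).le (θ * v) θ v z) h_bound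

end IsTypicalPath

section Likelihood

/-- The mean of the conditional log-likelihood criteria of a pair of sites, each conditioned on the
other. -/
noncomputable def symmLogLik (z : unitInterval → ℝ) (ψ : ℝ × ℝ) (s t : unitInterval) : ℝ :=
  (condLogLik z t s ψ + condLogLik z s t ψ) / 2

variable {z : unitInterval → ℝ} {ψ : ℝ × ℝ} {s t : unitInterval}

lemma one_sub_exp_neg_two_mul_pos {u : ℝ} (hu : 0 < u) : 0 < 1 - Real.exp (-(2 * u)) :=
  sub_pos.2 (Real.exp_lt_one_iff.2 (by linarith))

lemma sq_one_sub_exp_neg_le_mul {u : ℝ} (hu : 0 ≤ u) :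
    (1 - Real.exp (-u)) ^ 2 ≤ u * (1 - Real.exp (-(2 * u))) := by
  have h_exp : Real.exp (-(2 * u)) = Real.exp (-u) ^ 2 := by
    rw [← Real.exp_nat_mul]
    ring_nf
  have h_le : 1 - Real.exp (-u) ≤ u * (1 + Real.exp (-u)) := by
    nlinarith [Real.one_sub_le_exp_neg u, Real.exp_pos (-u)]
  nlinarith [mul_le_mul_of_nonneg_left h_le
    (sub_nonneg.2 (Real.exp_le_one_iff.2 (neg_nonpos.2 hu)))]

lemma symmLogLik_eq (h_scale : 0 < ψ.1) (h_var : 0 < ψ.2) (hst : s < t) :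
    symmLogLik z ψ s t = Real.log (ψ.2 * (1 - Real.exp (-(2 * (ψ.1 * gap s t))))) +
      (2 * Real.exp (-(ψ.1 * gap s t)) * (z t - z s) ^ 2 +
          (1 - Real.exp (-(ψ.1 * gap s t))) ^ 2 * sqSum z s t) /
        (2 * (ψ.2 * (1 - Real.exp (-(2 * (ψ.1 * gap s t)))))) := by
  have h_abs : |(s : ℝ) - t| = gap s t := by
    rw [abs_sub_comm]
    exact abs_of_pos (gap_pos hst)
  have h_pos := one_sub_exp_neg_two_mul_pos (mul_pos h_scale (gap_pos hst))
  rw [symmLogLik, condLogLik, condLogLik, abs_sub_comm (t : ℝ), h_abs, sqSum,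
    Real.log_mul h_var.ne' h_pos.ne', show -2 * ψ.1 * gap s t = -(2 * (ψ.1 * gap s t)) by ring,
    neg_mul]
  field_simp
  ring

lemma scaledIncrement_mul_sq {x : ℝ} (hx : 0 ≤ x) (G : ℝ) (z : unitInterval → ℝ)
    (s t : unitInterval) :
    scaledIncrement (x * G) z s t ^ 2 = scaledIncrement G z s t ^ 2 / x := by
  rw [scaledIncrement, scaledIncrement, show 2 * (x * G) * gap s t = x * (2 * G * gap s t) by ring,
    Real.sqrt_mul hx, div_pow, div_pow, mul_pow, Real.sq_sqrt hx, div_div, mul_comm x]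

lemma scaledIncrement_sq {G : ℝ} (hG : 0 ≤ G) (z : unitInterval → ℝ) (hst : s ≤ t) :
    scaledIncrement G z s t ^ 2 = (z t - z s) ^ 2 / (2 * G * gap s t) := by
  have h_gap := gap_nonneg hst
  rw [scaledIncrement, div_pow, Real.sq_sqrt (by positivity)]

lemma log_sub_le_log_mul_one_sub_exp {v u : ℝ} (hv : 0 < v) (hu : 0 < u) :
    Real.log (2 * v * u) - u ≤ Real.log (v * (1 - Real.exp (-(2 * u)))) := by
  have h_log : Real.log (2 * v * u) - u = Real.log (2 * v * u * Real.exp (-u)) := by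
    rw [Real.log_mul (by positivity) (Real.exp_pos _).ne', Real.log_exp, sub_eq_add_neg]
  rw [h_log]
  refine Real.log_le_log (by positivity) ?_
  nlinarith [two_mul_exp_neg_mul_le hu.le]

lemma log_sub_add_le_symmLogLik (h_scale : 0 < ψ.1) (h_var : 0 < ψ.2) (z : unitInterval → ℝ)
    (hst : s < t) :
    Real.log (2 * (ψ.1 * ψ.2) * gap s t) - ψ.1 * gap s t +
        (1 - ψ.1 * gap s t) * scaledIncrement (ψ.1 * ψ.2) z s t ^ 2 ≤
      symmLogLik z ψ s t := by
  have hu : 0 < ψ.1 * gap s t := mul_pos h_scale (gap_pos hst)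
  rw [symmLogLik_eq h_scale h_var hst, scaledIncrement_sq (by positivity) z hst.le,
    show 2 * (ψ.1 * ψ.2) * gap s t = 2 * ψ.2 * (ψ.1 * gap s t) by ring]
  set u := ψ.1 * gap s t
  have h_pos := one_sub_exp_neg_two_mul_pos hu
  have h_quad : (1 - u) * ((z t - z s) ^ 2 / (2 * ψ.2 * u)) ≤
      (2 * Real.exp (-u) * (z t - z s) ^ 2 + (1 - Real.exp (-u)) ^ 2 * sqSum z s t) /
        (2 * (ψ.2 * (1 - Real.exp (-(2 * u))))) := by
    have h_coeff : (1 - u) * (1 - Real.exp (-(2 * u))) ≤ Real.exp (-u) * (2 * u) :=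
      mul_le_mul (Real.one_sub_le_exp_neg u) (one_sub_exp_neg_two_mul_le u) h_pos.le
        (Real.exp_pos _).le
    have h_sq := mul_le_mul_of_nonneg_left h_coeff
      (mul_nonneg (mul_nonneg zero_le_two h_var.le) (sq_nonneg (z t - z s)))
    have h_sqSum : 0 ≤ (1 - Real.exp (-u)) ^ 2 * sqSum z s t * (2 * ψ.2 * u) := by
      rw [sqSum]
      positivity
    rw [← mul_div_assoc, div_le_div_iff₀ (by positivity) (by positivity)]
    linarith
  linarith [log_sub_le_log_mul_one_sub_exp h_var hu]

lemma symmLogLik_le (h_scale : 0 < ψ.1) (h_var : 0 < ψ.2) (z : unitInterval → ℝ) (hst : s < t) :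
    symmLogLik z ψ s t ≤ Real.log (2 * (ψ.1 * ψ.2) * gap s t) +
      scaledIncrement (ψ.1 * ψ.2) z s t ^ 2 + ψ.1 / (2 * ψ.2) * (gap s t * sqSum z s t) := by
  have hu : 0 < ψ.1 * gap s t := mul_pos h_scale (gap_pos hst)
  rw [symmLogLik_eq h_scale h_var hst, scaledIncrement_sq (by positivity) z hst.le,
    show 2 * (ψ.1 * ψ.2) * gap s t = 2 * ψ.2 * (ψ.1 * gap s t) by ring,
    show ψ.1 / (2 * ψ.2) * (gap s t * sqSum z s t) =
      ψ.1 * gap s t * sqSum z s t / (2 * ψ.2) by ring]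
  set u := ψ.1 * gap s t
  have h_pos := one_sub_exp_neg_two_mul_pos hu
  have h_log : Real.log (ψ.2 * (1 - Real.exp (-(2 * u)))) ≤ Real.log (2 * ψ.2 * u) := by
    refine Real.log_le_log (by positivity) ?_
    nlinarith [one_sub_exp_neg_two_mul_le u]
  have h_increment : 2 * Real.exp (-u) * (z t - z s) ^ 2 / (2 * (ψ.2 * (1 - Real.exp (-(2 * u))))) ≤
      (z t - z s) ^ 2 / (2 * ψ.2 * u) := by
    rw [div_le_div_iff₀ (by positivity) (by positivity)]
    have := mul_le_mul_of_nonneg_left (two_mul_exp_neg_mul_le hu.le)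
      (mul_nonneg (mul_nonneg zero_le_two h_var.le) (sq_nonneg (z t - z s)))
    linarith
  have h_sqSum : (1 - Real.exp (-u)) ^ 2 * sqSum z s t / (2 * (ψ.2 * (1 - Real.exp (-(2 * u))))) ≤
      u * sqSum z s t / (2 * ψ.2) := by
    have := mul_le_mul_of_nonneg_left (sq_one_sub_exp_neg_le_mul hu.le)
      (mul_nonneg (mul_nonneg zero_le_two h_var.le)
        (add_nonneg (sq_nonneg (z s)) (sq_nonneg (z t))))
    rw [sqSum, div_le_div_iff₀ (by positivity) (by positivity)]
    linarith
  rw [add_div]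
  linarith

lemma log_sub_le_symmLogLik {B c : ℝ} (hB : 0 < B) (hc : 0 < c) (h_scale : B ≤ ψ.1)
    (h_var : c ≤ ψ.2) (z : unitInterval → ℝ) (hst : s < t) :
    Real.log (2 * (B * c) * gap s t) - B * gap s t ≤ symmLogLik z ψ s t := by
  have h_gap := gap_pos hst
  have hψ₁ := hB.trans_le h_scale
  have hψ₂ := hc.trans_le h_var
  have h_pos_B := one_sub_exp_neg_two_mul_pos (mul_pos hB h_gap)
  have h_pos := one_sub_exp_neg_two_mul_pos (mul_pos hψ₁ h_gap)
  have h_quad : 0 ≤ (2 * Real.exp (-(ψ.1 * gap s t)) * (z t - z s) ^ 2 +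
      (1 - Real.exp (-(ψ.1 * gap s t))) ^ 2 * sqSum z s t) /
        (2 * (ψ.2 * (1 - Real.exp (-(2 * (ψ.1 * gap s t)))))) := by
    rw [sqSum]
    positivity
  calc Real.log (2 * (B * c) * gap s t) - B * gap s t
      = Real.log (2 * c * (B * gap s t)) - B * gap s t := by ring_nf
    _ ≤ Real.log (c * (1 - Real.exp (-(2 * (B * gap s t))))) :=
        log_sub_le_log_mul_one_sub_exp hc (mul_pos hB h_gap)
    _ ≤ Real.log (ψ.2 * (1 - Real.exp (-(2 * (ψ.1 * gap s t))))) := by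
        gcongr
    _ ≤ symmLogLik z ψ s t := by
        rw [symmLogLik_eq hψ₁ hψ₂ hst]
        exact le_add_of_nonneg_right h_quad

end Likelihood

section Comparison

lemma sum_sum_ne_eq_sum_lt {ι M : Type*} [Fintype ι] [LinearOrder ι] [AddCommMonoid M]
    (g : ι → ι → M) :
    ∑ i, ∑ j with j ≠ i, g i j = ∑ p : ι × ι with p.1 < p.2, (g p.1 p.2 + g p.2 p.1) := by
  have h_swap : ∑ p : ι × ι with p.1 < p.2, g p.2 p.1 = ∑ p : ι × ι with p.2 < p.1, g p.1 p.2 :=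
    Finset.sum_equiv (Equiv.prodComm ι ι) (fun p => by simp) fun p _ => rfl
  have h_disjoint : Disjoint (Finset.univ.filter fun p : ι × ι => p.1 < p.2)
      (Finset.univ.filter fun p : ι × ι => p.2 < p.1) :=
    Finset.disjoint_filter.2 fun p _ h => h.not_gt
  rw [Finset.sum_add_distrib, h_swap, ← Finset.sum_union h_disjoint, ← Finset.filter_or]
  simp only [lt_or_lt_iff_ne, ne_comm, Finset.sum_filter, Fintype.sum_prod_type]

variable {n : ℕ} {w : ℕ → ℝ} {K : ℕ} {z : unitInterval → ℝ} {ψ ψ₀ : ℝ × ℝ}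

lemma pairMean_symmLogLik (w : ℕ → ℝ) (s : Fin n → unitInterval) (z : unitInterval → ℝ)
    (ψ : ℝ × ℝ) :
    pairMean w s (symmLogLik z ψ) = pairCondLogLik w s z ψ /
      (2 * ∑ p : Fin n × Fin n with p.1 < p.2, w (p.2 - p.1)) := by
  have h_sum : pairCondLogLik w s z ψ =
      2 * ∑ p : Fin n × Fin n with p.1 < p.2, w (p.2 - p.1) * symmLogLik z ψ (s p.1) (s p.2) := by
    rw [pairCondLogLik, sum_sum_ne_eq_sum_lt, Finset.mul_sum]
    refine Finset.sum_congr rfl fun p hp => ?_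
    have h_lt : (p.1 : ℕ) ≤ p.2 := (Finset.mem_filter.1 hp).2.le
    rw [Nat.dist_eq_sub_of_le h_lt, Nat.dist_eq_sub_of_le_right h_lt, symmLogLik]
    ring
  rw [h_sum, mul_div_mul_left _ _ two_ne_zero]
  rfl

lemma IsLagWeight.pairMean_symmLogLik_le (hw : IsLagWeight w K) {s : Fin n → unitInterval}
    (h : pairCondLogLik w s z ψ ≤ pairCondLogLik w s z ψ₀) :
    pairMean w s (symmLogLik z ψ) ≤ pairMean w s (symmLogLik z ψ₀) := by
  rw [pairMean_symmLogLik, pairMean_symmLogLik]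
  have h_nonneg : 0 ≤ ∑ p : Fin n × Fin n with p.1 < p.2, w (p.2 - p.1) :=
    Finset.sum_nonneg fun p hp => hw.weight_nonneg (Finset.mem_filter.1 hp).2
  gcongr

/-- The squared scaled increment of a pair of sites, increased by error terms of vanishing weighted
mean: those in the upper bound `symmLogLik_le` at a reference parameter `ψ₀`, and the one in the
lower bounds at parameters of scale at most, or at least, `B`. -/
noncomputable def perturbedSq (ψ₀ : ℝ × ℝ) (B : ℝ) (z : unitInterval → ℝ) :
    unitInterval → unitInterval → ℝ :=
  scaledIncrement (ψ₀.1 * ψ₀.2) z ^ 2 + (ψ₀.1 / (2 * ψ₀.2)) • (gap * sqSum z) + B • gap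

/-- The squared scaled increment of a pair of sites, reduced by its first-order correction in the
gap of the sites for parameters of scale at most `B`. -/
noncomputable def dampedSq (G B : ℝ) (z : unitInterval → ℝ) : unitInterval → unitInterval → ℝ :=
  scaledIncrement G z ^ 2 - B • (gap * scaledIncrement G z ^ 2)

lemma log_add_dampedSq_div_le {B : ℝ} {s t : unitInterval} (hst : s < t)
    (hψ₀ : 0 < ψ₀.1 ∧ 0 < ψ₀.2) (hψ : 0 < ψ.1 ∧ 0 < ψ.2) (hB : ψ.1 ≤ B) (z : unitInterval → ℝ) :
    Real.log (ψ.1 * ψ.2 / (ψ₀.1 * ψ₀.2)) +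
        dampedSq (ψ₀.1 * ψ₀.2) B z s t / (ψ.1 * ψ.2 / (ψ₀.1 * ψ₀.2)) ≤
      symmLogLik z ψ s t - symmLogLik z ψ₀ s t + perturbedSq ψ₀ B z s t := by
  have h_gap := gap_pos hst
  have hG : 0 < ψ₀.1 * ψ₀.2 := mul_pos hψ₀.1 hψ₀.2
  set x := ψ.1 * ψ.2 / (ψ₀.1 * ψ₀.2)
  have hx : 0 < x := div_pos (mul_pos hψ.1 hψ.2) hG
  have hx_mul : ψ.1 * ψ.2 = x * (ψ₀.1 * ψ₀.2) := (div_mul_cancel₀ _ hG.ne').symm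
  have h_lower := log_sub_add_le_symmLogLik hψ.1 hψ.2 z hst
  have h_upper := symmLogLik_le hψ₀.1 hψ₀.2 z hst
  have h_log : Real.log (2 * (x * (ψ₀.1 * ψ₀.2)) * gap s t) =
      Real.log x + Real.log (2 * (ψ₀.1 * ψ₀.2) * gap s t) := by
    rw [← Real.log_mul hx.ne' (by positivity)]
    ring_nf
  rw [hx_mul, h_log, scaledIncrement_mul_sq hx.le] at h_lower
  have h_scale : ψ.1 * gap s t ≤ B * gap s t := by gcongr
  have h_damped : dampedSq (ψ₀.1 * ψ₀.2) B z s t / x ≤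
      (1 - ψ.1 * gap s t) * (scaledIncrement (ψ₀.1 * ψ₀.2) z s t ^ 2 / x) := by
    simp only [dampedSq, Pi.sub_apply, Pi.smul_apply, Pi.mul_apply, Pi.pow_apply, smul_eq_mul]
    rw [← mul_div_assoc]
    gcongr
    nlinarith [sq_nonneg (scaledIncrement (ψ₀.1 * ψ₀.2) z s t)]
  simp only [perturbedSq, Pi.add_apply, Pi.smul_apply, Pi.mul_apply, Pi.pow_apply, smul_eq_mul]
  linarith

lemma log_le_symmLogLik_sub_add {B c : ℝ} {s t : unitInterval} (hst : s < t)
    (hψ₀ : 0 < ψ₀.1 ∧ 0 < ψ₀.2) (hB : 0 < B) (hc : 0 < c) (h_scale : B ≤ ψ.1) (h_var : c ≤ ψ.2)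
    (z : unitInterval → ℝ) :
    Real.log (B * c / (ψ₀.1 * ψ₀.2)) ≤
      symmLogLik z ψ s t - symmLogLik z ψ₀ s t + perturbedSq ψ₀ B z s t := by
  have h_gap := gap_pos hst
  have hG : 0 < ψ₀.1 * ψ₀.2 := mul_pos hψ₀.1 hψ₀.2
  have h_lower := log_sub_le_symmLogLik hB hc h_scale h_var z hst
  have h_upper := symmLogLik_le hψ₀.1 hψ₀.2 z hst
  have h_log : Real.log (2 * (B * c) * gap s t) =
      Real.log (B * c / (ψ₀.1 * ψ₀.2)) + Real.log (2 * (ψ₀.1 * ψ₀.2) * gap s t) := by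
    rw [← Real.log_mul (by positivity) (by positivity)]
    congr 1
    rw [div_mul_eq_mul_div, eq_div_iff hG.ne']
    ring
  simp only [perturbedSq, Pi.add_apply, Pi.smul_apply, Pi.mul_apply, Pi.pow_apply, smul_eq_mul]
  linarith

lemma IsLagWeight.log_add_pairMean_dampedSq_div_le (hw : IsLagWeight w K)
    {s : Fin n → unitInterval} (hs : StrictMono s) (h_one : pairMean w s 1 = 1) {B : ℝ}
    (hψ₀ : 0 < ψ₀.1 ∧ 0 < ψ₀.2) (hψ : 0 < ψ.1 ∧ 0 < ψ.2) (hB : ψ.1 ≤ B)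
    (h_le : pairCondLogLik w s z ψ ≤ pairCondLogLik w s z ψ₀) :
    Real.log (ψ.1 * ψ.2 / (ψ₀.1 * ψ₀.2)) +
        pairMean w s (dampedSq (ψ₀.1 * ψ₀.2) B z) / (ψ.1 * ψ.2 / (ψ₀.1 * ψ₀.2)) ≤
      pairMean w s (perturbedSq ψ₀ B z) := by
  have h_mono := hw.pairMean_mono (s := s) (g := symmLogLik z ψ - symmLogLik z ψ₀ +
    perturbedSq ψ₀ B z) (f := Real.log (ψ.1 * ψ.2 / (ψ₀.1 * ψ₀.2)) • 1 +
      (ψ.1 * ψ.2 / (ψ₀.1 * ψ₀.2))⁻¹ • dampedSq (ψ₀.1 * ψ₀.2) B z) fun i j hij => by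
    simpa [div_eq_inv_mul] using log_add_dampedSq_div_le (hs hij) hψ₀ hψ hB z
  rw [map_add, map_smul, map_smul, map_add, map_sub, h_one] at h_mono
  simp only [smul_eq_mul, mul_one, ← div_eq_inv_mul] at h_mono
  linarith [hw.pairMean_symmLogLik_le h_le]

lemma IsLagWeight.log_le_pairMean_perturbedSq (hw : IsLagWeight w K)
    {s : Fin n → unitInterval} (hs : StrictMono s) (h_one : pairMean w s 1 = 1) {B c : ℝ}
    (hψ₀ : 0 < ψ₀.1 ∧ 0 < ψ₀.2) (hB : 0 < B) (hc : 0 < c) (h_scale : B ≤ ψ.1) (h_var : c ≤ ψ.2)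
    (h_le : pairCondLogLik w s z ψ ≤ pairCondLogLik w s z ψ₀) :
    Real.log (B * c / (ψ₀.1 * ψ₀.2)) ≤ pairMean w s (perturbedSq ψ₀ B z) := by
  have h_mono := hw.pairMean_mono (s := s) (f := Real.log (B * c / (ψ₀.1 * ψ₀.2)) • 1)
    (g := symmLogLik z ψ - symmLogLik z ψ₀ + perturbedSq ψ₀ B z) fun i j hij => by
    simpa using log_le_symmLogLik_sub_add (hs hij) hψ₀ hB hc h_scale h_var z
  rw [map_smul, map_add, map_sub, h_one, smul_eq_mul, mul_one] at h_mono
  linarith [hw.pairMean_symmLogLik_le h_le]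

end Comparison

section Consistency

lemma sq_sqrt_sub_one_le {v : ℝ} (hv : 0 < v) : (√v - 1) ^ 2 ≤ v - 1 - Real.log v := by
  have h_log : Real.log v ≤ 2 * (√v - 1) := by
    linarith [Real.log_sqrt hv.le, Real.log_le_sub_one_of_pos (Real.sqrt_pos.2 hv)]
  nlinarith [Real.sq_sqrt hv.le]

-- `log x + p / x` is least at `x = p`, where its value is `log p + 1`.
lemma tendsto_one_of_log_add_div_le {ι : Type*} {l : Filter ι} {x p r : ι → ℝ}
    (hp : Tendsto p l (𝓝 1)) (hr : Tendsto r l (𝓝 1)) (hx : ∀ᶠ i in l, 0 < x i)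
    (h : ∀ᶠ i in l, Real.log (x i) + p i / x i ≤ r i) : Tendsto x l (𝓝 1) := by
  have hp_pos : ∀ᶠ i in l, 0 < p i := hp.eventually_const_lt zero_lt_one
  have h_excess : Tendsto (fun i => r i - 1 - Real.log (p i)) l (𝓝 0) := by
    simpa using (hr.sub_const 1).sub (hp.log one_ne_zero)
  have h_sq : Tendsto (fun i => (√(p i / x i) - 1) ^ 2) l (𝓝 0) := by
    refine squeeze_zero' (.of_forall fun i => sq_nonneg _) ?_ h_excess
    filter_upwards [hp_pos, hx, h] with i hpi hxi hi
    have h_log := Real.log_div hpi.ne' hxi.ne'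
    linarith [sq_sqrt_sub_one_le (div_pos hpi hxi)]
  have h_sqrt : Tendsto (fun i => √(p i / x i)) l (𝓝 1) := by
    have h_abs := h_sq.sqrt
    simp only [Real.sqrt_sq_eq_abs, Real.sqrt_zero] at h_abs
    simpa using ((tendsto_zero_iff_abs_tendsto_zero _).2 h_abs).add_const 1
  have h_div : Tendsto (fun i => p i / √(p i / x i) ^ 2) l (𝓝 1) := by
    simpa only [one_pow, div_one, Pi.div_def] using hp.div (h_sqrt.pow 2) (by norm_num)
  refine h_div.congr' ?_
  filter_upwards [hp_pos, hx] with i hpi hxi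
  rw [Real.sq_sqrt (div_pos hpi hxi).le, div_div_cancel₀ hpi.ne']

/-- A parameter set for which the likelihood criterion has minimizers with product near the true
one: it is relatively closed in the open quadrant, the scale is bounded above or else the variance
is bounded away from `0`, and the scale is bounded away from `0` or else the variance is bounded
above. -/
structure IsAdmissibleParamSet (J : Set (ℝ × ℝ)) : Prop where
  exists_isClosed : ∃ F, IsClosed F ∧ J = F ∩ Ioi 0 ×ˢ Ioi 0
  exists_fst_le_or_le_snd : ∃ b c, 0 < c ∧ ∀ ψ ∈ J, ψ.1 ≤ b ∨ c ≤ ψ.2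
  exists_le_fst_or_snd_le : ∃ a d, 0 < a ∧ 0 < d ∧ ∀ ψ ∈ J, a ≤ ψ.1 ∨ ψ.2 ≤ d

variable {J : Set (ℝ × ℝ)}

lemma isAdmissibleParamSet_of_eq {a b c d : ℝ} (ha : 0 < a) (hc : 0 < c) (hcd : c ≤ d)
    (hJ : J = Icc a b ×ˢ Icc c d ∨ J = Icc a b ×ˢ Ioi (0 : ℝ) ∨ J = Ioi (0 : ℝ) ×ˢ Icc c d) :
    IsAdmissibleParamSet J := by
  have h_scale : Icc a b ∩ Ioi 0 = Icc a b := inter_eq_left.2 fun x hx => ha.trans_le hx.1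
  have h_var : Icc c d ∩ Ioi 0 = Icc c d := inter_eq_left.2 fun x hx => hc.trans_le hx.1
  have hd : 0 < d := hc.trans_le hcd
  rcases hJ with rfl | rfl | rfl
  · exact ⟨⟨Icc a b ×ˢ Icc c d, isClosed_Icc.prod isClosed_Icc,
      by rw [prod_inter_prod, h_scale, h_var]⟩,
      ⟨b, c, hc, fun ψ hψ => .inl hψ.1.2⟩, ⟨a, d, ha, hd, fun ψ hψ => .inl hψ.1.1⟩⟩
  · exact ⟨⟨Icc a b ×ˢ univ, isClosed_Icc.prod isClosed_univ,
      by rw [prod_inter_prod, h_scale, univ_inter]⟩,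
      ⟨b, c, hc, fun ψ hψ => .inl hψ.1.2⟩, ⟨a, d, ha, hd, fun ψ hψ => .inl hψ.1.1⟩⟩
  · exact ⟨⟨univ ×ˢ Icc c d, isClosed_univ.prod isClosed_Icc,
      by rw [prod_inter_prod, h_var, univ_inter]⟩,
      ⟨b, c, hc, fun ψ hψ => .inr hψ.2.1⟩, ⟨a, d, ha, hd, fun ψ hψ => .inr hψ.2.2⟩⟩

namespace IsAdmissibleParamSet

lemma subset_quadrant (hJ : IsAdmissibleParamSet J) : J ⊆ Ioi 0 ×ˢ Ioi 0 := by
  obtain ⟨F, -, rfl⟩ := hJ.exists_isClosed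
  exact inter_subset_right

lemma exists_isCompact (hJ : IsAdmissibleParamSet J) {B g g' : ℝ} (hB : 0 < B) (hg : 0 < g) :
    ∃ Q ⊆ J, IsCompact Q ∧ ∀ ψ ∈ J, ψ.1 ≤ B → ψ.1 * ψ.2 ∈ Icc g g' → ψ ∈ Q := by
  have h_quadrant := hJ.subset_quadrant
  obtain ⟨a, d, ha, hd, h_or⟩ := hJ.exists_le_fst_or_snd_le
  obtain ⟨F, hF, rfl⟩ := hJ.exists_isClosed
  have h_low : 0 < min a (g / d) := lt_min ha (div_pos hg hd)
  refine ⟨F ∩ Icc (min a (g / d)) B ×ˢ Icc (g / B) (max d (g' / a)),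
    inter_subset_inter_right F (prod_mono (fun x hx => h_low.trans_le hx.1)
      fun x hx => (div_pos hg hB).trans_le hx.1),
    (isCompact_Icc.prod isCompact_Icc).inter_left hF, fun ψ hψ hψB hψg => ?_⟩
  obtain ⟨h_scale_pos : 0 < ψ.1, h_var_pos : 0 < ψ.2⟩ := h_quadrant hψ
  refine ⟨hψ.1, ⟨?_, hψB⟩, ?_, ?_⟩
  · refine (h_or ψ hψ).elim (min_le_left _ _).trans fun h => (min_le_right _ _).trans ?_
    rw [div_le_iff₀ hd]
    exact hψg.1.trans (by gcongr)
  · rw [div_le_iff₀' hB]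
    exact hψg.1.trans (by gcongr)
  · refine (h_or ψ hψ).elim (fun h => le_max_of_le_right ?_) le_max_of_le_left
    rw [le_div_iff₀' ha]
    exact le_trans (by gcongr) hψg.2

end IsAdmissibleParamSet

lemma continuousOn_condLogLik (z : unitInterval → ℝ) {s t : unitInterval} (hst : s ≠ t) :
    ContinuousOn (condLogLik z t s) (Ioi 0 ×ˢ Ioi 0) := by
  have h_dist : 0 < |(s : ℝ) - t| := abs_pos.2 (sub_ne_zero.2 (Subtype.coe_ne_coe.2 hst))
  have h_ne : ∀ ψ ∈ Ioi (0 : ℝ) ×ˢ Ioi (0 : ℝ), 1 - Real.exp (-2 * ψ.1 * |(s : ℝ) - t|) ≠ 0 := by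
    rintro ψ ⟨hψ : 0 < ψ.1, -⟩
    refine (sub_pos.2 (Real.exp_lt_one_iff.2 ?_)).ne'
    nlinarith [mul_pos hψ h_dist]
  have h_var : ∀ ψ ∈ Ioi (0 : ℝ) ×ˢ Ioi (0 : ℝ), ψ.2 ≠ 0 := fun ψ hψ => (mem_Ioi.1 hψ.2).ne'
  have h_cont : Continuous fun ψ : ℝ × ℝ => 1 - Real.exp (-2 * ψ.1 * |(s : ℝ) - t|) := by
    fun_prop
  refine ((continuousOn_snd.log h_var).add (h_cont.continuousOn.log h_ne)).add
    (ContinuousOn.div ?_ (continuousOn_snd.mul h_cont.continuousOn)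
      fun ψ hψ => mul_ne_zero (h_var ψ hψ) (h_ne ψ hψ))
  fun_prop

lemma continuousOn_pairCondLogLik (w : ℕ → ℝ) {n : ℕ} {s : Fin n → unitInterval}
    (hs : Function.Injective s) (z : unitInterval → ℝ) :
    ContinuousOn (pairCondLogLik w s z) (Ioi 0 ×ˢ Ioi 0) :=
  continuousOn_finsetSum _ fun _ _ => continuousOn_finsetSum _ fun _ hj =>
    continuousOn_const.mul (continuousOn_condLogLik z (hs.ne (Finset.mem_filter.1 hj).2.symm))

lemma exists_isWPCMLE_of_isCompact {w : ℕ → ℝ} {n : ℕ} {s : Fin n → unitInterval}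
    {z : unitInterval → ℝ} {Q : Set (ℝ × ℝ)} {ψ₀ : ℝ × ℝ}
    (h_cont : ContinuousOn (pairCondLogLik w s z) Q) (hQ : IsCompact Q) (hQJ : Q ⊆ J)
    (hψ₀ : ψ₀ ∈ Q)
    (h_sublevel : ∀ ψ ∈ J, pairCondLogLik w s z ψ ≤ pairCondLogLik w s z ψ₀ → ψ ∈ Q) :
    ∃ ψ, IsWPCMLE J w s z ψ := by
  obtain ⟨ψ, hψ, h_min⟩ := hQ.exists_isMinOn ⟨ψ₀, hψ₀⟩ h_cont
  refine ⟨ψ, hQJ hψ, fun φ hφ => ?_⟩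
  rcases le_total (pairCondLogLik w s z φ) (pairCondLogLik w s z ψ₀) with h | h
  · exact h_min (h_sublevel φ hφ h)
  · exact (h_min hψ₀).trans h

lemma eventually_forall_of_forall_seq {α : Type*} {q r : ℕ → α → Prop} (hq : ∀ n, ∃ a, q n a)
    (h : ∀ u : ℕ → α, (∀ n, q n (u n)) → ∀ᶠ n in atTop, r n (u n)) :
    ∀ᶠ n in atTop, ∀ a, q n a → r n a := by
  have h_choice (n : ℕ) : ∃ a, q n a ∧ (r n a → ∀ b, q n b → r n b) := by
    by_cases h_all : ∀ b, q n b → r n b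
    · exact (hq n).imp fun a ha => ⟨ha, fun _ => h_all⟩
    · push Not at h_all
      exact h_all.imp fun a ha => ⟨ha.1, fun hr => absurd hr ha.2⟩
  choose u hqu hru using h_choice
  exact (h u hqu).mono fun n hn => hru n hn

namespace IsTypicalPath

variable {w : ℕ → ℝ} {K : ℕ} {θ v : ℝ} {s : (n : ℕ) → Fin n → unitInterval}
  {z : unitInterval → ℝ} {ψ₀ : ℝ × ℝ}

lemma tendsto_pairMean_dampedSq (h : IsTypicalPath w θ v s z) (hw : IsLagWeight w K)
    (hs : ∀ n, StrictMono (s n)) (hθ : 0 < θ) (hv : 0 < v) (B : ℝ) :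
    Tendsto (fun n => pairMean w (s n) (dampedSq (θ * v) B z)) atTop (𝓝 1) := by
  simpa only [dampedSq, map_sub, map_smul, smul_eq_mul, mul_zero, sub_zero] using
    (h.tendsto_pairMean_scaledIncrement_sq hw hs hθ hv).sub
      ((h.tendsto_pairMean_gap_mul_scaledIncrement_sq hw hs hθ hv).const_mul B)

lemma tendsto_pairMean_perturbedSq (h : IsTypicalPath w θ v s z) (hw : IsLagWeight w K)
    (hs : ∀ n, StrictMono (s n)) (hθ : 0 < θ) (hv : 0 < v) (hψ₀ : ψ₀.1 * ψ₀.2 = θ * v) (B : ℝ) :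
    Tendsto (fun n => pairMean w (s n) (perturbedSq ψ₀ B z)) atTop (𝓝 1) := by
  simpa only [perturbedSq, hψ₀, map_add, map_smul, smul_eq_mul, mul_zero, add_zero] using
    ((h.tendsto_pairMean_scaledIncrement_sq hw hs hθ hv).add
      ((h.tendsto_pairMean_gap_mul_sqSum hw hs).const_mul (ψ₀.1 / (2 * ψ₀.2)))).add
        ((hw.tendsto_pairMean_gap fun n => (hs n).monotone).const_mul B)

lemma exists_eventually_forall_fst_le (h : IsTypicalPath w θ v s z) (hw : IsLagWeight w K)
    (hs : ∀ n, StrictMono (s n)) (hθ : 0 < θ) (hv : 0 < v) (hJ : IsAdmissibleParamSet J)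
    (hψ₀J : ψ₀ ∈ J) (hψ₀ : ψ₀.1 * ψ₀.2 = θ * v) :
    ∃ B, 0 < B ∧ ∀ᶠ n in atTop, ∀ ψ ∈ J,
      pairCondLogLik w (s n) z ψ ≤ pairCondLogLik w (s n) z ψ₀ → ψ.1 ≤ B := by
  obtain ⟨b, c, hc, h_or⟩ := hJ.exists_fst_le_or_le_snd
  have hG : 0 < θ * v := mul_pos hθ hv
  set B := max b (Real.exp 2 * (θ * v) / c)
  have hB : 0 < B := lt_max_of_lt_right (by positivity)
  have h_log : 2 ≤ Real.log (B * c / (ψ₀.1 * ψ₀.2)) := by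
    rw [Real.le_log_iff_exp_le (by rw [hψ₀]; positivity), hψ₀, le_div_iff₀ hG, ← div_le_iff₀ hc]
    exact le_max_right _ _
  refine ⟨B, hB, ?_⟩
  filter_upwards [hw.eventually_pairMean_one s,
    (h.tendsto_pairMean_perturbedSq hw hs hθ hv hψ₀ B).eventually_lt_const one_lt_two]
    with n h_one h_lt ψ hψ h_le
  by_contra! hψB
  have h_var : c ≤ ψ.2 := (h_or ψ hψ).resolve_left fun hb => hψB.not_ge (le_max_of_le_left hb)
  linarith [hw.log_le_pairMean_perturbedSq (hs n) h_one (hJ.subset_quadrant hψ₀J) hB hc hψB.le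
    h_var h_le]

theorem tendsto_mul_of_pairCondLogLik_le (h : IsTypicalPath w θ v s z) (hw : IsLagWeight w K)
    (hs : ∀ n, StrictMono (s n)) (hθ : 0 < θ) (hv : 0 < v) (hJ : IsAdmissibleParamSet J)
    (hψ₀J : ψ₀ ∈ J) (hψ₀ : ψ₀.1 * ψ₀.2 = θ * v) {ψ : ℕ → ℝ × ℝ} (hψ : ∀ᶠ n in atTop, ψ n ∈ J)
    (h_le : ∀ᶠ n in atTop,
      pairCondLogLik w (s n) z (ψ n) ≤ pairCondLogLik w (s n) z ψ₀) :
    Tendsto (fun n => (ψ n).1 * (ψ n).2) atTop (𝓝 (θ * v)) := by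
  have hG : 0 < θ * v := mul_pos hθ hv
  obtain ⟨B, -, hB⟩ := h.exists_eventually_forall_fst_le hw hs hθ hv hJ hψ₀J hψ₀
  have h_ratio : Tendsto (fun n => (ψ n).1 * (ψ n).2 / (θ * v)) atTop (𝓝 1) := by
    refine tendsto_one_of_log_add_div_le (h.tendsto_pairMean_dampedSq hw hs hθ hv B)
      (h.tendsto_pairMean_perturbedSq hw hs hθ hv hψ₀ B) ?_ ?_
    · filter_upwards [hψ] with n hn
      exact div_pos (mul_pos (hJ.subset_quadrant hn).1 (hJ.subset_quadrant hn).2) hG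
    · filter_upwards [hψ, h_le, hB, hw.eventually_pairMean_one s] with n hn h_le_n hB_n h_one
      simpa only [hψ₀] using hw.log_add_pairMean_dampedSq_div_le (hs n) h_one
        (hJ.subset_quadrant hψ₀J) (hJ.subset_quadrant hn) (hB_n _ hn h_le_n) h_le_n
  simpa only [div_mul_cancel₀ _ hG.ne', one_mul] using h_ratio.mul_const (θ * v)

theorem eventually_exists_isWPCMLE (h : IsTypicalPath w θ v s z) (hw : IsLagWeight w K)
    (hs : ∀ n, StrictMono (s n)) (hθ : 0 < θ) (hv : 0 < v) (hJ : IsAdmissibleParamSet J)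
    (hψ₀J : ψ₀ ∈ J) (hψ₀ : ψ₀.1 * ψ₀.2 = θ * v) :
    ∀ᶠ n in atTop, ∃ ψ, IsWPCMLE J w (s n) z ψ := by
  have hG : 0 < θ * v := mul_pos hθ hv
  obtain ⟨B, hB_pos, hB⟩ := h.exists_eventually_forall_fst_le hw hs hθ hv hJ hψ₀J hψ₀
  obtain ⟨Q, hQJ, hQ, h_mem⟩ := hJ.exists_isCompact hB_pos (g' := 2 * (θ * v)) (half_pos hG)
  have h_mul : ∀ᶠ n in atTop, ∀ ψ,
      ψ ∈ J ∧ pairCondLogLik w (s n) z ψ ≤ pairCondLogLik w (s n) z ψ₀ →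
        ψ.1 * ψ.2 ∈ Icc (θ * v / 2) (2 * (θ * v)) :=
    eventually_forall_of_forall_seq (fun n => ⟨ψ₀, hψ₀J, le_rfl⟩) fun ψ hψ =>
      h.tendsto_mul_of_pairCondLogLik_le hw hs hθ hv hJ hψ₀J hψ₀ (.of_forall fun n => (hψ n).1)
        (.of_forall fun n => (hψ n).2) (Icc_mem_nhds (by linarith) (by linarith))
  filter_upwards [hB, h_mul] with n hB_n h_mul_n
  have h_sublevel : ∀ ψ ∈ J,
      pairCondLogLik w (s n) z ψ ≤ pairCondLogLik w (s n) z ψ₀ → ψ ∈ Q :=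
    fun ψ hψ h_le => h_mem ψ hψ (hB_n ψ hψ h_le) (h_mul_n ψ ⟨hψ, h_le⟩)
  exact exists_isWPCMLE_of_isCompact
    ((continuousOn_pairCondLogLik w (hs n).injective z).mono (hQJ.trans hJ.subset_quadrant))
    hQ hQJ (h_sublevel ψ₀ hψ₀J le_rfl) h_sublevel

end IsTypicalPath

end Consistency

theorem theorem2_general {Ω : Type*} [MeasurableSpace Ω] (P : Measure Ω) [IsProbabilityMeasure P]
    (θ₀ v₀ : ℝ) (hθ₀ : 0 < θ₀) (hv₀ : 0 < v₀)
    (Z : unitInterval → Ω → ℝ) (hZ : IsStationaryOU P Z θ₀ v₀)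
    (s : (n : ℕ) → Fin n → unitInterval) (hs : ∀ n, StrictMono (s n))
    (w : ℕ → ℝ) (hw_nonneg : ∀ k, 1 ≤ k → 0 ≤ w k) (hw_ne : ∃ k, 1 ≤ k ∧ w k ≠ 0)
    (hw_fin : {k | 1 ≤ k ∧ w k ≠ 0}.Finite)
    (J : Set (ℝ × ℝ)) (hJ : IsAdmissibleParamSet J)
    (hJ_mem : ∃ ψ ∈ J, ψ.1 * ψ.2 = θ₀ * v₀) :
    ∀ᵐ ω ∂P,
      (∀ᶠ n in atTop, ∃ ψ, IsWPCMLE J w (s n) (fun t => Z t ω) ψ) ∧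
      ∀ ψhat : ℕ → ℝ × ℝ,
        (∀ᶠ n in atTop, IsWPCMLE J w (s n) (fun t => Z t ω) (ψhat n)) →
        Tendsto (fun n => (ψhat n).1 * (ψhat n).2) atTop (𝓝 (θ₀ * v₀)) := by
  obtain ⟨K, hw⟩ := exists_isLagWeight hw_nonneg hw_ne hw_fin
  obtain ⟨ψ₀, hψ₀J, hψ₀⟩ := hJ_mem
  filter_upwards [hZ.ae_isTypicalPath hθ₀ hv₀ hs hw] with ω h
  refine ⟨h.eventually_exists_isWPCMLE hw hs hθ₀ hv₀ hJ hψ₀J hψ₀, fun ψhat hψhat => ?_⟩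
  exact h.tendsto_mul_of_pairCondLogLik_le hw hs hθ₀ hv₀ hJ hψ₀J hψ₀
    (hψhat.mono fun n hn => hn.1) (hψhat.mono fun n hn => hn.2 ψ₀ hψ₀J)

theorem theorem2 {Ω : Type*} [MeasurableSpace Ω] (P : Measure Ω) [IsProbabilityMeasure P]
    (θ₀ v₀ : ℝ) (hθ₀ : 0 < θ₀) (hv₀ : 0 < v₀)
    (Z : unitInterval → Ω → ℝ) (hZ : IsStationaryOU P Z θ₀ v₀)
    (s : (n : ℕ) → Fin n → unitInterval) (hs : ∀ n, StrictMono (s n))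
    (w : ℕ → ℝ) (hw_nonneg : ∀ k, 1 ≤ k → 0 ≤ w k) (hw_ne : ∃ k, 1 ≤ k ∧ w k ≠ 0)
    (hw_fin : {k | 1 ≤ k ∧ w k ≠ 0}.Finite)
    (a b c d : ℝ) (ha : 0 < a) (hab : a ≤ b) (hc : 0 < c) (hcd : c ≤ d)
    (J : Set (ℝ × ℝ))
    (hJ : J = Icc a b ×ˢ Icc c d ∨ J = Icc a b ×ˢ Ioi (0 : ℝ) ∨ J = Ioi (0 : ℝ) ×ˢ Icc c d)
    (hJ_mem : ∃ ψ ∈ J, ψ.1 * ψ.2 = θ₀ * v₀) :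
    ∀ᵐ ω ∂P,
      (∀ᶠ n in atTop, ∃ ψ, IsWPCMLE J w (s n) (fun t => Z t ω) ψ) ∧
      ∀ ψhat : ℕ → ℝ × ℝ,
        (∀ᶠ n in atTop, IsWPCMLE J w (s n) (fun t => Z t ω) (ψhat n)) →
        Tendsto (fun n => (ψhat n).1 * (ψhat n).2) atTop (𝓝 (θ₀ * v₀)) :=
  theorem2_general P θ₀ v₀ hθ₀ hv₀ Z hZ s hs w hw_nonneg hw_ne hw_fin J
    (isAdmissibleParamSet_of_eq ha hc hcd hJ) hJ_mem
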